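/- Let $\mathbb H=\{(z_1,z_2)\in\mathbb C^2:|z_1|<|z_2|<1\}$ be the Hartogs triangle, $dV$ Lebesgue measure, $|\cdot|$ the Lebesgue measure of a set, $L^2(\mathbb H)=L^2(\mathbb H,dV)$, and $A^2(\mathbb H)$ the space of holomorphic functions in $L^2(\mathbb H)$. There is a (unique) Bergman kernel $K(z;\bar w)$ on $\mathbb H\times\mathbb H$, that is, a function such that $w\mapsto\overline{K(z;\bar w)}$ belongs to $A^2(\mathbb H)$ for every $z\in\mathbb H$ and such that for every $f\in L^2(\mathbb H)$ the function $$Pf(z)=\int_{\mathbb H}K(z;\bar w)f(w)\,dV(w)$$ is the orthogonal projection of $f$ onto $A^2(\mathbb H)$. For $\varepsilon\in\mathbb R$ let $L^{4/3}(\mathbb H,(-\log|z_2|+1)^\varepsilon)$ be the space of measurable $f$ on $\mathbb H$ with $$\|f\|_\varepsilon=\Bigl(\int_{\mathbb H}|f(z)|^{4/3}(-\log|z_2|+1)^{\varepsilon}\,dV(z)\Bigr)^{3/4}<\infty.$$ (i) For every $\varepsilon>\frac13$, the integral defining $Pf(z)$ converges absolutely for all $f\in L^{4/3}(\mathbb H,(-\log|z_2|+1)^\varepsilon)$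 and all $z\in\mathbb H$, and there is a constant $C$, depending only on $\varepsilon$, such that for all such $f$ and all $\lambda>0$ $$|\{z\in\mathbb H:|Pf(z)|>\lambda\}|\le C\,\frac{\|f\|_{\varepsilon}^{4/3}}{\lambda^{4/3}}.$$ (ii) For every $\varepsilon\le\frac13$, and in particular for $\varepsilon=\frac13$, there is no constant $C$ for which the estimate in (i) holds for all $\lambda>0$ and all $f\in L^{4/3}(\mathbb H,(-\log|z_2|+1)^\varepsilon)\cap L^2(\mathbb H)$. -/

import Mathlib

open MeasureTheory Set
open scoped NNReal ENNReal ComplexConjugate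

noncomputable section

/-- The Hartogs triangle. -/
def hartogsTriangle : Set (ℂ × ℂ) :=
  {z | ‖z.1‖ < ‖z.2‖ ∧ ‖z.2‖ < 1}

/-- The Bergman space `A²(Ω)`: functions holomorphic on `Ω` and square-integrable over `Ω` with
respect to Lebesgue measure. (Values off `Ω` are irrelevant.) -/
def bergmanSpace (Ω : Set (ℂ × ℂ)) : Set (ℂ × ℂ → ℂ) :=
  {f | DifferentiableOn ℂ f Ω ∧ MemLp f 2 (volume.restrict Ω)}

/-- `g` is the holomorphic representative of the orthogonal projection of `f ∈ L²(Ω)` onto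
`A²(Ω)`: it lies in `A²(Ω)` and `f - g` is orthogonal to `A²(Ω)`. -/
def IsOrthogonalProjectionToBergmanSpace (Ω : Set (ℂ × ℂ)) (f g : ℂ × ℂ → ℂ) : Prop :=
  g ∈ bergmanSpace Ω ∧ ∀ h ∈ bergmanSpace Ω, ∫ w in Ω, (f w - g w) * conj (h w) = 0

/-- The integral operator with kernel `K` over `Ω`. -/
def kernelOperator (Ω : Set (ℂ × ℂ)) (K : ℂ × ℂ → ℂ × ℂ → ℂ) (f : ℂ × ℂ → ℂ) (z : ℂ × ℂ) : ℂ :=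
  ∫ w in Ω, K z w * f w

/-- `K` (with `K z w` standing for `K_Ω(z; w̄)`) is the Bergman kernel of `Ω`: it is
antiholomorphic and square-integrable in `w`, and integration against it is the orthogonal
projection of `L²(Ω)` onto `A²(Ω)`. These properties determine `K` on `Ω × Ω`. -/
structure IsBergmanKernel (Ω : Set (ℂ × ℂ)) (K : ℂ × ℂ → ℂ × ℂ → ℂ) : Prop where
  conj_mem : ∀ z ∈ Ω, (fun w => conj (K z w)) ∈ bergmanSpace Ω
  projection : ∀ f : ℂ × ℂ → ℂ, MemLp f 2 (volume.restrict Ω) →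
    IsOrthogonalProjectionToBergmanSpace Ω f (kernelOperator Ω K f)

/-- The Bergman kernel of `Ω`. -/
def bergmanKernel (Ω : Set (ℂ × ℂ)) : ℂ × ℂ → ℂ × ℂ → ℂ :=
  Classical.epsilon (IsBergmanKernel Ω)

/-- The Bergman projection of `Ω`, `P f (z) = ∫_Ω K_Ω(z; w̄) f(w) dV(w)`. -/
def bergmanProjection (Ω : Set (ℂ × ℂ)) (f : ℂ × ℂ → ℂ) (z : ℂ × ℂ) : ℂ :=
  kernelOperator Ω (bergmanKernel Ω) f z

/-- The measure `(-log |z₂| + 1) ^ ε dV` on the Hartogs triangle. The base of the power is greater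
than `1` there. -/
def logWeightedMeasure (ε : ℝ) : Measure (ℂ × ℂ) :=
  (volume.restrict hartogsTriangle).withDensity
    (fun z => ENNReal.ofReal ((-Real.log ‖z.2‖ + 1) ^ ε))

/-- The inequality
`|{z ∈ ℍ : |P f (z)| > t}| ≤ C ‖f‖^{4/3} / t^{4/3}` for all `t > 0`, with the norm of
`L^{4/3}(ℍ, (-log |z₂| + 1) ^ ε)` on the right. -/
def WeakFourThirdsBound (ε : ℝ) (C : ℝ≥0) (f : ℂ × ℂ → ℂ) : Prop :=
  ∀ t : ℝ, 0 < t →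
    volume {z ∈ hartogsTriangle | t < ‖bergmanProjection hartogsTriangle f z‖} ≤
      C * (eLpNorm f (4 / 3) (logWeightedMeasure ε)) ^ (4 / 3 : ℝ) /
        ENNReal.ofReal (t ^ (4 / 3 : ℝ))

end

open Metric Filter Topology

/-! ### Polar coordinates -/

/-! The map `(u, v) ↦ (u v, v)` sends the disc times the punctured disc biholomorphically onto the
Hartogs triangle, with complex Jacobian `v`. Hence `f ↦ F = v f(u v, v)` is an isometry of `L²`
spaces. Since `L²` holomorphic functions extend across `v = 0`, the Bergman kernel is the product of
two disc kernels divided by `π² z₂ conj w₂` (`isBergmanKernel_hartogsKernel`). The kernel chosen by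
`Classical.epsilon` agrees with it a.e. in `w`, by uniqueness.

On the bidisc the norm becomes `∫ |F|^(4/3) W` with `W(v) = |v|^(2/3) (1 - log |v|)^ε`, while `|P
f|^(4/3)` acquires only the factor `|v|^(2/3) ≤ 1`. So for `ε > 1/3` it suffices to bound the
absolute disc kernels from `L^(4/3)(W)` to the unweighted `L^(4/3)`. In `u`, and in `v` away from
`0`, this is Schur's test. For `v` near `0` the kernel is bounded and Hölder's inequality needs `∫
W^(-3) = ∫ |v|^(-2) (1 - log |v|)^(-3ε) < ∞`, which holds exactly when `3ε > 1`. This gives a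
strong-type bound (`exists_lintegral_kernelOperator_rpow_le`), and Chebyshev's inequality gives the
weak one.

For `ε ≤ 1/3`, take `F = |v|^(-2) (1 - log |v|)^(-1)`, cut off at `|v| = δ`. It is radial, so
projecting it on the bidisc gives a constant, and `P f = 2s / z₂` with `s = log (1 - log δ)`. Thus
`|P f| > 2s` on the whole domain while `‖f‖^(4/3) ≤ 2π² s`; the weak estimate would force `s^(4/3) ≲
s` as `s → ∞`. -/

theorem polarCoord_symm_eq_circleMap (p : ℝ × ℝ) :
    Complex.polarCoord.symm p = circleMap 0 p.1 p.2 := by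
  rw [Complex.polarCoord_symm_apply, circleMap, zero_add, Complex.exp_mul_I, Complex.ofReal_cos,
    Complex.ofReal_sin]

theorem lintegral_polar {F : ℂ → ℝ≥0∞} (hF : Measurable F) :
    ∫⁻ z, F z = ∫⁻ r in Ioi (0 : ℝ), ENNReal.ofReal r *
      ∫⁻ θ in Ioo (-Real.pi) Real.pi, F (circleMap 0 r θ) := by
  rw [← Complex.lintegral_comp_polarCoord_symm]
  simp only [polarCoord_symm_eq_circleMap, polarCoord_target, smul_eq_mul]
  rw [Measure.volume_eq_prod, ← Measure.prod_restrict, lintegral_prod]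
  · refine lintegral_congr fun r => ?_
    have hm : Measurable fun θ => F (circleMap 0 r θ) :=
      hF.comp (continuous_circleMap 0 r).measurable
    rw [← lintegral_const_mul _ hm]
  · refine Measurable.aemeasurable (Measurable.mul (by fun_prop) (hF.comp ?_))
    unfold circleMap
    fun_prop

theorem setLIntegral_ball_polar {F : ℂ → ℝ≥0∞} (hF : Measurable F) (R : ℝ) :
    ∫⁻ z in ball 0 R, F z = ∫⁻ r in Ioo (0 : ℝ) R, ENNReal.ofReal r *
      ∫⁻ θ in Ioo (-Real.pi) Real.pi, F (circleMap 0 r θ) := by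
  rw [← lintegral_indicator measurableSet_ball, lintegral_polar (hF.indicator measurableSet_ball),
    ← lintegral_indicator measurableSet_Ioi, ← lintegral_indicator measurableSet_Ioo]
  refine lintegral_congr fun r => ?_
  by_cases hr : 0 < r
  · have hmem : ∀ θ, circleMap 0 r θ ∈ ball (0 : ℂ) R ↔ r < R := fun θ => by
      simp [abs_of_pos hr]
    by_cases hR : r < R <;> simp [indicator, hr, hR, abs_of_pos hr]
  · simp [indicator, hr]

theorem setLIntegral_ball_radial {φ : ℝ → ℝ≥0∞} (hφ : Measurable φ) (R : ℝ) :
    ∫⁻ z in ball (0 : ℂ) R, φ ‖z‖ =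
      ENNReal.ofReal (2 * Real.pi) * ∫⁻ r in Ioo (0 : ℝ) R, ENNReal.ofReal r * φ r := by
  rw [setLIntegral_ball_polar (F := fun z => φ ‖z‖) (hφ.comp measurable_norm),
    ← lintegral_const_mul _ (by fun_prop)]
  refine setLIntegral_congr_fun measurableSet_Ioo fun r hr => ?_
  simp only [norm_circleMap_zero, abs_of_pos hr.1, lintegral_const, Measure.restrict_apply,
    MeasurableSet.univ, univ_inter, Real.volume_Ioo]
  rw [show Real.pi - -Real.pi = 2 * Real.pi by ring]
  ring

theorem integral_Ioo_circleMap {E : Type*} [NormedAddCommGroup E] [NormedSpace ℝ E] (F : ℂ → E)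
    (r : ℝ) : ∫ θ in Ioo (-Real.pi) Real.pi, F (circleMap 0 r θ) =
      (2 * Real.pi) • Real.circleAverage F 0 r := by
  have hper : Function.Periodic (fun θ => F (circleMap 0 r θ)) (2 * Real.pi) := fun θ => by
    simp only [periodic_circleMap 0 r θ]
  rw [Real.circleAverage_def, smul_smul, mul_inv_cancel₀ Real.two_pi_pos.ne', one_smul,
    ← integral_Ioc_eq_integral_Ioo, ← intervalIntegral.integral_of_le (by linarith [Real.pi_pos])]
  have := hper.intervalIntegral_add_eq (-Real.pi) 0
  rw [show -Real.pi + 2 * Real.pi = Real.pi by ring, zero_add] at this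
  exact this

theorem setIntegral_ball_polar {F : ℂ → ℂ} {R : ℝ} (hF : IntegrableOn F (ball 0 R)) :
    ∫ z in ball 0 R, F z = ∫ r in Ioo (0 : ℝ) R, (2 * Real.pi * r) • Real.circleAverage F 0 r := by
  obtain ⟨G, hG, hFG⟩ : ∃ G : ℂ → ℂ, G = (ball 0 R).indicator F ∧ True := ⟨_, rfl, trivial⟩
  have hGi : Integrable G := by rw [hG]; exact hF.integrable_indicator measurableSet_ball
  have hint : IntegrableOn (fun p : ℝ × ℝ => p.1 • G (Complex.polarCoord.symm p))
      polarCoord.target := by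
    have h1 := (integrableOn_image_iff_integrableOn_abs_det_fderiv_smul volume
        polarCoord.open_target.measurableSet
        (fun p _ => (hasFDerivAt_polarCoord_symm p).hasFDerivWithinAt)
        polarCoord.symm.injOn (fun q => G (Complex.measurableEquivRealProd.symm q))).1
        (Integrable.integrableOn
          ((Complex.volume_preserving_equiv_real_prod.symm).integrable_comp_of_integrable hGi))
    refine h1.congr_fun (fun p hp => ?_) polarCoord.open_target.measurableSet
    simp only [det_fderivPolarCoordSymm, abs_of_pos (show 0 < p.1 from hp.1)]
    rfl
  rw [← integral_indicator measurableSet_ball, ← hG, ← Complex.integral_comp_polarCoord_symm]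
  rw [polarCoord_target, Measure.volume_eq_prod] at hint ⊢
  rw [setIntegral_prod _ hint, ← integral_indicator measurableSet_Ioi,
    ← integral_indicator measurableSet_Ioo]
  refine integral_congr_ae (Eventually.of_forall fun r => ?_)
  by_cases hr : 0 < r
  · by_cases hR : r < R
    · simp only [indicator, hG, polarCoord_symm_eq_circleMap, mem_Ioi, hr, mem_Ioo, hR,
        mem_ball, dist_zero_right, norm_circleMap_zero, abs_of_pos hr, and_self, if_true]
      rw [integral_smul, integral_Ioo_circleMap, smul_smul]
      congr 1; ring
    · simp [indicator, hG, hr, hR, abs_of_pos hr]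
  · simp [indicator, hr]

/-! ### Circle averages against the Bergman kernel of the disc -/

theorem one_sub_mul_conj_ne_zero {z v : ℂ} (hz : ‖z‖ < 1) (hv : ‖v‖ < 1) : 1 - z * conj v ≠ 0 := by
  intro h
  have h1 : z * conj v = 1 := (sub_eq_zero.1 h).symm
  have h2 : ‖z‖ * ‖v‖ = 1 := by simpa using congrArg norm h1
  nlinarith [norm_nonneg z, norm_nonneg v]

theorem one_sub_norm_le_norm_one_sub_mul_conj {z v : ℂ} (hv : ‖v‖ < 1) :
    1 - ‖z‖ ≤ ‖1 - z * conj v‖ := by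
  have h := norm_sub_norm_le (1 : ℂ) (z * conj v)
  rw [norm_one, norm_mul, RCLike.norm_conj] at h
  nlinarith [norm_nonneg z, norm_nonneg v]

/-- On `|v| = r` one has `conj v = r² / v`, which turns the Bergman kernel into a Cauchy kernel with
pole `z r²`. -/
theorem one_sub_mul_conj_mul_self {z v : ℂ} {r : ℝ} (hv : ‖v‖ = r) :
    (1 - z * conj v) * v = v - z * r ^ 2 := by
  have h : v * conj v = (r : ℂ) ^ 2 := by rw [Complex.mul_conj']; simp [hv]
  linear_combination (-z) * h

/-- After rewriting the denominator as `(v - z r²)² / v²`, the average is Cauchy's integral for the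
derivative of `v h(v)` at `z r²`. -/
theorem circleAverage_mul_bergmanKernel {h : ℂ → ℂ} (hh : DifferentiableOn ℂ h (ball 0 1))
    {z : ℂ} (hz : ‖z‖ < 1) {r : ℝ} (hr0 : 0 < r) (hr1 : r < 1) :
    Real.circleAverage (fun v => h v / (1 - z * conj v) ^ 2) 0 r =
      deriv (fun v => v * h v) (z * r ^ 2) := by
  have hw : z * (r : ℂ) ^ 2 ∈ ball (0 : ℂ) r := by
    simp only [mem_ball, dist_zero_right, norm_mul, norm_pow, Complex.norm_real, Real.norm_eq_abs,
      abs_of_pos hr0]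
    have : r ^ 2 < r := by nlinarith
    nlinarith [norm_nonneg z]
  have hsub : closedBall (0 : ℂ) r ⊆ ball 0 1 := closedBall_subset_ball hr1
  rw [← Complex.two_pi_I_inv_smul_circleIntegral_sub_sq_inv_smul_of_differentiable isOpen_ball hsub
      (f := fun v => v * h v) (differentiableOn_id.mul hh) hw,
    Real.circleAverage_eq_circleIntegral hr0.ne']
  congr 1
  refine circleIntegral.integral_congr hr0.le fun v hv => ?_
  have hvr : ‖v‖ = r := by simpa using hv
  have hv0 : v ≠ 0 := norm_pos_iff.1 (hvr ▸ hr0)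
  have h1 := one_sub_mul_conj_ne_zero hz (hvr ▸ hr1 : ‖v‖ < 1)
  simp only [sub_zero, smul_eq_mul]
  rw [← one_sub_mul_conj_mul_self hvr]
  field_simp

/-- Up to the factor `1 - |z|² r²`, the integrand is the Poisson kernel of the circle at the point
`z r²`, which has average `1`. -/
theorem circleAverage_norm_bergmanKernel {z : ℂ} (hz : ‖z‖ < 1) {r : ℝ} (hr0 : 0 < r)
    (hr1 : r < 1) :
    Real.circleAverage (fun v => (‖1 - z * conj v‖ ^ 2)⁻¹) 0 r = (1 - ‖z‖ ^ 2 * r ^ 2)⁻¹ := by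
  have hz' : ‖z * (r : ℂ) ^ 2‖ = ‖z‖ * r ^ 2 := by simp
  have hw : z * (r : ℂ) ^ 2 ∈ ball (0 : ℂ) r := by
    rw [mem_ball_zero_iff, hz']
    have : r ^ 2 < r := by nlinarith
    nlinarith [norm_nonneg z]
  have hpos : 0 < 1 - ‖z‖ ^ 2 * r ^ 2 := by
    have : ‖z‖ * r < 1 := by nlinarith [norm_nonneg z]
    nlinarith [mul_nonneg (norm_nonneg z) hr0.le]
  -- The Poisson formula is applied to the complex constant `1`; `h3` then brings the identity back
  -- to real averages.
  have key := (diffContOnCl_const (c := (1 : ℂ))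
    (s := ball (0 : ℂ) r)).circleAverage_poissonKernel_smul' hw
  have h2 : Real.circleAverage (fun v => (‖v - 0‖ ^ 2 - ‖z * (r : ℂ) ^ 2 - 0‖ ^ 2) /
      ‖(v - 0) - (z * (r : ℂ) ^ 2 - 0)‖ ^ 2) 0 r = 1 := by
    have h3 : ∀ g : ℂ → ℝ, Real.circleAverage (fun v => g v • (1 : ℂ)) 0 r =
        ((Real.circleAverage g 0 r : ℝ) : ℂ) := fun g => by
      simp [Real.circleAverage_def, intervalIntegral.integral_ofReal]
    rw [h3] at key
    exact_mod_cast key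
  have h4 : Real.circleAverage (fun v => (‖v - 0‖ ^ 2 - ‖z * (r : ℂ) ^ 2 - 0‖ ^ 2) /
      ‖(v - 0) - (z * (r : ℂ) ^ 2 - 0)‖ ^ 2) 0 r =
      Real.circleAverage (fun v => (1 - ‖z‖ ^ 2 * r ^ 2) • (‖1 - z * conj v‖ ^ 2)⁻¹) 0 r := by
    refine Real.circleAverage_congr_sphere fun v hv => ?_
    have hvr : ‖v‖ = r := by simpa [abs_of_pos hr0] using hv
    have h1 := one_sub_mul_conj_ne_zero hz (hvr ▸ hr1 : ‖v‖ < 1)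
    simp only [sub_zero, hz', hvr, ← one_sub_mul_conj_mul_self hvr, norm_mul, smul_eq_mul]
    have := norm_pos_iff.2 h1
    field_simp
  rw [h4, Real.circleAverage_fun_smul, smul_eq_mul] at h2
  exact eq_inv_of_mul_eq_one_right h2

/-! ### The Bergman projection of the punctured disc -/

theorem setIntegral_ball_eq_of_circleAverage {F : ℂ → ℂ} {R : ℝ} {c : ℂ}
    (hF : IntegrableOn F (ball 0 R)) (hR : 0 ≤ R)
    (havg : ∀ r ∈ Ioo 0 R, Real.circleAverage F 0 r = c) :
    ∫ z in ball 0 R, F z = (Real.pi * R ^ 2 : ℝ) • c := by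
  rw [setIntegral_ball_polar hF, setIntegral_congr_fun measurableSet_Ioo
    (g := fun r : ℝ => (2 * Real.pi * r) • c) (fun r hr => by simp only [havg r hr]),
    integral_smul_const, ← integral_Ioc_eq_integral_Ioo, ← intervalIntegral.integral_of_le hR,
    intervalIntegral.integral_const_mul, integral_id]
  congr 1; ring

theorem setIntegral_ball_of_differentiableOn {F : ℂ → ℂ} {c : ℂ} {R : ℝ} (hR : 0 ≤ R)
    (hF : DifferentiableOn ℂ F (closedBall c R)) :
    ∫ z in ball c R, F z = (Real.pi * R ^ 2 : ℝ) • F c := by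
  have htr : ∫ z in ball c R, F z = ∫ z in ball 0 R, F (z + c) := by
    rw [← integral_indicator measurableSet_ball, ← integral_indicator measurableSet_ball,
      ← integral_add_right_eq_self _ c]
    refine integral_congr_ae (Eventually.of_forall fun z => ?_)
    simp [indicator, dist_eq_norm]
  have hmaps : MapsTo (fun z : ℂ => z + c) (closedBall 0 R) (closedBall c R) := fun z hz => by
    simpa [dist_eq_norm] using hz
  have hF' : DifferentiableOn ℂ (fun z => F (z + c)) (closedBall 0 R) :=
    hF.comp (differentiableOn_id.add_const c) hmaps
  rw [htr, setIntegral_ball_eq_of_circleAverage (c := F c) _ hR]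
  · intro r hr
    have hd : DiffContOnCl ℂ (fun z => F (z + c)) (ball 0 |r|) := by
      rw [abs_of_pos hr.1]
      exact (hF'.mono (closedBall_subset_closedBall hr.2.le)).diffContOnCl_ball Subset.rfl
    rw [hd.circleAverage, zero_add]
  · exact (hF'.continuousOn.integrableOn_compact (isCompact_closedBall _ _)).mono_set
      ball_subset_closedBall

/-- The mean value property of the holomorphic function `h²` replaces subharmonicity of `|h|²`. -/
theorem enorm_sq_mul_le_setLIntegral {h : ℂ → ℂ} {c : ℂ} {R : ℝ} (hR : 0 ≤ R)
    (hh : DifferentiableOn ℂ h (closedBall c R)) :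
    ENNReal.ofReal (Real.pi * R ^ 2) * ‖h c‖ₑ ^ 2 ≤ ∫⁻ z in ball c R, ‖h z‖ₑ ^ 2 := by
  have h1 := setIntegral_ball_of_differentiableOn hR (hh.pow 2)
  have h2 := enorm_integral_le_lintegral_enorm (μ := volume.restrict (ball c R)) (fun z => h z ^ 2)
  simp only [Pi.pow_apply] at h1
  rw [h1, enorm_smul, Real.enorm_eq_ofReal (by positivity)] at h2
  simpa only [enorm_pow] using h2

/-- The mean value bound on `ball c (‖c‖ / 2)` controls `‖c‖² ‖h c‖²` by the integral of `‖h‖²` over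
that ball, and this tends to `0` with the volume of the ball by absolute continuity of the integral.
-/
theorem isLittleO_inv_of_memLp_two {h : ℂ → ℂ} (hd : DifferentiableOn ℂ h (ball 0 1 \ {0}))
    (hL : MemLp h 2 (volume.restrict (ball 0 1))) : h =o[𝓝[≠] 0] fun z => z⁻¹ := by
  have hfin : ∫⁻ z in ball (0 : ℂ) 1, ‖h z‖ₑ ^ 2 ≠ ∞ := by
    have := (lintegral_rpow_enorm_lt_top_of_eLpNorm_lt_top (p := 2) (by simp) (by simp)
      hL.eLpNorm_lt_top).ne
    simpa using this
  have hvol : Tendsto (fun c : ℂ => volume.restrict (ball (0 : ℂ) 1) (ball c (‖c‖ / 2))) (𝓝[≠] 0)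
      (𝓝 0) := by
    refine tendsto_of_tendsto_of_tendsto_of_le_of_le tendsto_const_nhds
      (h := fun c : ℂ => ENNReal.ofReal (‖c‖ / 2) ^ 2 * NNReal.pi) ?_ (fun _ => zero_le)
      (fun c => (Measure.restrict_apply_le _ _).trans (Complex.volume_ball c _).le)
    have : Continuous fun c : ℂ => ENNReal.ofReal (‖c‖ / 2) ^ 2 * NNReal.pi :=
      ENNReal.continuous_mul_const (by simp) |>.comp
        ((ENNReal.continuous_pow 2).comp (ENNReal.continuous_ofReal.comp (by fun_prop)))
    have := (this.tendsto 0).mono_left (nhdsWithin_le_nhds (s := {0}ᶜ))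
    simpa using this
  have hlim := tendsto_setLIntegral_zero hfin hvol
  rw [Asymptotics.isLittleO_iff]
  intro ε hε
  have hev : ∀ᶠ c : ℂ in 𝓝[≠] 0, ∫⁻ z in ball c (‖c‖ / 2), ‖h z‖ₑ ^ 2
      ∂(volume.restrict (ball (0 : ℂ) 1)) < ENNReal.ofReal (Real.pi / 4 * ε ^ 2) :=
    hlim.eventually_lt_const (by simpa using by positivity)
  have hsmall : ∀ᶠ c : ℂ in 𝓝[≠] 0, ‖c‖ < 1 / 2 := by
    refine eventually_nhdsWithin_of_eventually_nhds ?_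
    exact (continuous_norm.tendsto (0 : ℂ)).eventually_lt_const (by simp)
  filter_upwards [hev, hsmall, self_mem_nhdsWithin] with c hc hc1 hc0
  have hcpos : 0 < ‖c‖ := norm_pos_iff.2 hc0
  have hsub : closedBall c (‖c‖ / 2) ⊆ ball 0 1 \ {0} := by
    intro z hz
    rw [mem_closedBall, dist_eq_norm] at hz
    have h1 := norm_sub_norm_le c z
    have h2 := norm_sub_norm_le z c
    rw [norm_sub_rev] at h1
    refine ⟨by rw [mem_ball_zero_iff]; linarith, fun h0 => ?_⟩
    rw [mem_singleton_iff.1 h0, zero_sub, norm_neg] at hz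
    linarith
  rw [Measure.restrict_restrict measurableSet_ball,
    inter_eq_left.2 (ball_subset_closedBall.trans (hsub.trans sdiff_subset))] at hc
  have key := (enorm_sq_mul_le_setLIntegral (by positivity) (hd.mono hsub)).trans_lt hc
  rw [← ofReal_norm, ← ENNReal.ofReal_pow (norm_nonneg _),
    ← ENNReal.ofReal_mul (by positivity)] at key
  have key2 := (ENNReal.ofReal_lt_ofReal_iff (by positivity)).1 key
  rw [norm_inv]
  have h3 : (‖h c‖ * ‖c‖) ^ 2 < ε ^ 2 := by
    have : Real.pi / 4 * (‖h c‖ * ‖c‖) ^ 2 < Real.pi / 4 * ε ^ 2 := by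
      calc _ = Real.pi * (‖c‖ / 2) ^ 2 * ‖h c‖ ^ 2 := by ring
        _ < _ := key2
    exact lt_of_mul_lt_mul_left this (by positivity)
  have h4 := lt_of_pow_lt_pow_left₀ 2 hε.le h3
  rw [← div_eq_mul_inv, le_div_iff₀ hcpos]
  exact h4.le

/-- Riemann's removable singularity theorem in its `o(1/z)` form. The value at `0` may have to
change. -/
theorem exists_differentiableOn_ball_eqOn {h : ℂ → ℂ}
    (hd : DifferentiableOn ℂ h (ball 0 1 \ {0}))
    (hL : MemLp h 2 (volume.restrict (ball 0 1))) :
    ∃ g : ℂ → ℂ, DifferentiableOn ℂ g (ball 0 1) ∧ ∀ z, z ≠ 0 → g z = h z := by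
  refine ⟨_, Complex.differentiableOn_update_limUnder_of_isLittleO (ball_mem_nhds 0 one_pos) hd ?_,
    fun z hz => Function.update_of_ne hz _ _⟩
  have h1 := isLittleO_inv_of_memLp_two hd hL
  simp only [sub_zero]
  refine h1.sub ?_
  refine Asymptotics.isLittleO_const_left.2 (Or.inr ?_)
  have : Tendsto (fun z : ℂ => ‖z⁻¹‖) (𝓝[≠] 0) atTop := by
    simp only [norm_inv]
    exact (tendsto_norm_nhdsNE_zero (E := ℂ)).inv_tendsto_nhdsGT_zero
  exact this

theorem memLp_bounded_of_ball {g : ℂ → ℂ} (hg : ContinuousOn g (ball 0 1)) {C : ℝ}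
    (hC : ∀ v ∈ ball (0 : ℂ) 1, ‖g v‖ ≤ C) (p : ℝ≥0∞) :
    MemLp g p (volume.restrict (ball 0 1)) :=
  haveI : IsFiniteMeasure (volume.restrict (ball (0 : ℂ) 1)) :=
    isFiniteMeasure_restrict.2 measure_ball_lt_top.ne
  MemLp.of_bound (hg.aestronglyMeasurable measurableSet_ball) C
    ((ae_restrict_iff' measurableSet_ball).2 (Eventually.of_forall hC))

theorem memLp_discKernel {z : ℂ} (hz : ‖z‖ < 1) (p : ℝ≥0∞) :
    MemLp (fun v : ℂ => ((1 - z * conj v) ^ 2)⁻¹) p (volume.restrict (ball 0 1)) := by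
  refine memLp_bounded_of_ball (C := ((1 - ‖z‖) ^ 2)⁻¹) ?_ ?_ p
  · refine ContinuousOn.inv₀ (Continuous.continuousOn ?_) fun v hv =>
      pow_ne_zero 2 (one_sub_mul_conj_ne_zero hz (by simpa using hv))
    exact (continuous_const.sub (continuous_const.mul Complex.continuous_conj)).pow 2
  · intro v hv
    rw [norm_inv, norm_pow]
    have h1 := one_sub_norm_le_norm_one_sub_mul_conj (z := z) (v := v) (by simpa using hv)
    have h2 : 0 < 1 - ‖z‖ := by linarith
    gcongr

/-- The reproducing property of the Bergman kernel of the unit disc on the punctured disc. -/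
theorem integral_mul_discKernel {h : ℂ → ℂ} (hd : DifferentiableOn ℂ h (ball 0 1 \ {0}))
    (hL : MemLp h 2 (volume.restrict (ball 0 1))) {z : ℂ} (hz : ‖z‖ < 1) (hz0 : z ≠ 0) :
    ∫ v in ball 0 1, h v * ((1 - z * conj v) ^ 2)⁻¹ = Real.pi * h z := by
  obtain ⟨g, hg, hgh⟩ := exists_differentiableOn_ball_eqOn hd hL
  have hae : (fun v => h v * ((1 - z * conj v) ^ 2)⁻¹) =ᵐ[volume.restrict (ball 0 1)]
      fun v => g v / (1 - z * conj v) ^ 2 := by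
    have : ∀ᵐ v : ℂ ∂(volume.restrict (ball 0 1)), v ≠ 0 := by
      refine ae_restrict_of_ae ?_
      simp [ae_iff, measure_singleton]
    filter_upwards [this] with v hv
    rw [hgh v hv, div_eq_mul_inv]
  have hint : IntegrableOn (fun v => g v / (1 - z * conj v) ^ 2) (ball 0 1) :=
    (hL.integrable_mul (memLp_discKernel hz 2)).congr hae
  rw [integral_congr_ae hae, setIntegral_ball_polar hint, setIntegral_congr_fun measurableSet_Ioo
    (g := fun r : ℝ => (2 * Real.pi * r) • deriv (fun v => v * g v) (z * r ^ 2))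
    (fun r hr => by simp only [circleAverage_mul_bergmanKernel hg hz hr.1 hr.2]),
    ← integral_Ioc_eq_integral_Ioo, ← intervalIntegral.integral_of_le zero_le_one, ← hgh z hz0]
  have hf : DifferentiableOn ℂ (fun v => v * g v) (ball 0 1) := differentiableOn_id.mul hg
  have hmem : ∀ r ∈ uIcc (0 : ℝ) 1, z * (r : ℂ) ^ 2 ∈ ball (0 : ℂ) 1 := fun r hr => by
    rw [uIcc_of_le zero_le_one] at hr
    have h1 : r ^ 2 ≤ 1 := pow_le_one₀ hr.1 hr.2
    have h2 : ‖z * (r : ℂ) ^ 2‖ = ‖z‖ * r ^ 2 := by simp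
    rw [mem_ball_zero_iff, h2]
    nlinarith [norm_nonneg z]
  -- With `f(v) = v g(v)`, the integrand `2π r f'(z r²)` is the `r`-derivative of `(π / z) f(z r²)`;
  -- dividing by `z` is why `z ≠ 0` is assumed.
  rw [intervalIntegral.integral_eq_sub_of_hasDerivAt
    (f := fun r : ℝ => (Real.pi / z) * (z * (r : ℂ) ^ 2 * g (z * r ^ 2)))]
  · simp; field_simp
  · intro r hr
    have h1 : HasDerivAt (fun v => v * g v) (deriv (fun v => v * g v) (z * (r : ℂ) ^ 2))
        (z * (r : ℂ) ^ 2) := (hf.differentiableAt (isOpen_ball.mem_nhds (hmem r hr))).hasDerivAt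
    have h2 : HasDerivAt (fun x : ℂ => z * x ^ 2) (z * (2 * (r : ℂ))) (r : ℂ) := by
      simpa using ((hasDerivAt_pow 2 (r : ℂ)).const_mul z)
    have h3 := ((HasDerivAt.comp (r : ℂ) h1 h2).const_mul ((Real.pi : ℂ) / z)).comp_ofReal
    refine h3.congr_deriv ?_
    rw [Complex.real_smul]
    push_cast
    field_simp
  · refine ContinuousOn.intervalIntegrable ?_
    refine ContinuousOn.smul (f := fun r : ℝ => 2 * Real.pi * r) (by fun_prop) ?_
    have hc : ContinuousOn (fun r : ℝ => z * (r : ℂ) ^ 2) (uIcc 0 1) := by fun_prop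
    exact (hf.deriv isOpen_ball).continuousOn.comp hc hmem

/-- The kernel has average `1` on every circle about `0`, so a radial function integrates against it
as against `1`. This is what makes the projection of the extremizers explicit. -/
theorem integral_radial_mul_discKernel {φ : ℝ → ℂ}
    (hφ : IntegrableOn (fun v : ℂ => φ ‖v‖) (ball 0 1)) {z : ℂ} (hz : ‖z‖ < 1) :
    ∫ v in ball (0 : ℂ) 1, φ ‖v‖ * ((1 - z * conj v) ^ 2)⁻¹ = ∫ v in ball (0 : ℂ) 1, φ ‖v‖ := by
  have hint : IntegrableOn (fun v : ℂ => φ ‖v‖ * ((1 - z * conj v) ^ 2)⁻¹) (ball 0 1) :=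
    Integrable.mul_of_top_left hφ (memLp_discKernel hz ⊤)
  rw [setIntegral_ball_polar hint, setIntegral_ball_polar hφ]
  refine setIntegral_congr_fun measurableSet_Ioo fun r hr => ?_
  refine congrArg ((2 * Real.pi * r) • ·) ?_
  have h0 : Real.circleAverage (fun v : ℂ => (1 : ℂ) / (1 - z * conj v) ^ 2) 0 r = 1 := by
    rw [circleAverage_mul_bergmanKernel (differentiableOn_const 1) hz hr.1 hr.2]
    simp
  have h1 : ∀ f : ℂ → ℂ, Real.circleAverage (fun v => φ ‖v‖ * f v) 0 r =
      φ r * Real.circleAverage f 0 r := fun f => by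
    rw [← smul_eq_mul, ← Real.circleAverage_fun_smul]
    refine Real.circleAverage_congr_sphere fun v hv => ?_
    have : ‖v‖ = r := by simpa [abs_of_pos hr.1] using hv
    simp [this]
  have h2 := h1 fun _ => 1
  simp only [mul_one, Real.circleAverage_const] at h2
  rw [h1, h2]
  simp only [one_div] at h0
  rw [h0, mul_one]

/-! ### The Hartogs triangle as an image of the bidisc -/

theorem isOpen_hartogsTriangle : IsOpen hartogsTriangle :=
  (isOpen_lt (continuous_norm.comp continuous_fst) (continuous_norm.comp continuous_snd)).inter
    (isOpen_lt (continuous_norm.comp continuous_snd) continuous_const)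

theorem snd_ne_zero_of_mem_hartogsTriangle {z : ℂ × ℂ} (hz : z ∈ hartogsTriangle) : z.2 ≠ 0 :=
  norm_pos_iff.1 ((norm_nonneg _).trans_lt hz.1)

/-- The open unit bidisc. -/
def bidisc : Set (ℂ × ℂ) := ball 0 1 ×ˢ ball 0 1

theorem measurableSet_bidisc : MeasurableSet bidisc := measurableSet_ball.prod measurableSet_ball

/-- The map `(u, v) ↦ (u v, v)` from the bidisc to the Hartogs triangle. -/
def hartogsMap (p : ℂ × ℂ) : ℂ × ℂ := (p.1 * p.2, p.2)

theorem continuous_hartogsMap : Continuous hartogsMap := by unfold hartogsMap; fun_prop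

theorem hartogsMap_mem {p : ℂ × ℂ} (hp : p ∈ bidisc) (h0 : p.2 ≠ 0) :
    hartogsMap p ∈ hartogsTriangle := by
  have h1 : ‖p.1‖ < 1 := by simpa using hp.1
  have h2 : ‖p.2‖ < 1 := by simpa using hp.2
  have h3 : 0 < ‖p.2‖ := norm_pos_iff.2 h0
  refine ⟨?_, h2⟩
  simp only [hartogsMap, norm_mul]
  nlinarith

theorem lintegral_comp_mul_right {G : ℂ → ℝ≥0∞} (hG : Measurable G) {v : ℂ} (hv : v ≠ 0) :
    ‖v‖ₑ ^ 2 * ∫⁻ u, G (u * v) = ∫⁻ w, G w := by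
  have hdet : LinearMap.det (Algebra.lmul ℝ ℂ v) = ‖v‖ ^ 2 := by
    rw [← Algebra.norm_apply, Algebra.norm_complex_apply, Complex.normSq_eq_norm_sq]
  have hne : ‖v‖ ^ 2 ≠ 0 := pow_ne_zero 2 (norm_ne_zero_iff.2 hv)
  have hmap := Measure.map_linearMap_addHaar_eq_smul_addHaar (volume : Measure ℂ)
    (f := (Algebra.lmul ℝ ℂ v)) (by rw [hdet]; exact hne)
  have hcoe : ((Algebra.lmul ℝ ℂ v : ℂ →ₗ[ℝ] ℂ) : ℂ → ℂ) = fun u => u * v := by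
    ext u; simp [mul_comm]
  rw [hdet, hcoe] at hmap
  have h1 : ∫⁻ u, G (u * v) = ∫⁻ w, G w ∂(Measure.map (fun u => u * v) volume) :=
    (lintegral_map hG (by fun_prop)).symm
  rw [h1, hmap, lintegral_smul_measure, smul_eq_mul, ← mul_assoc, ← ofReal_norm,
    ← ENNReal.ofReal_pow (norm_nonneg _), ← ENNReal.ofReal_mul (by positivity),
    abs_of_pos (by positivity), mul_inv_cancel₀ hne, ENNReal.ofReal_one, one_mul]

/-- On the slice `z₂ = v` substitute `z₁ = u v`, whose real Jacobian is `‖v‖²`; the slice at `v = 0`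
is empty. -/
theorem setLIntegral_hartogsTriangle {F : ℂ × ℂ → ℝ≥0∞} (hF : Measurable F) :
    ∫⁻ w in hartogsTriangle, F w = ∫⁻ p in bidisc, ‖p.2‖ₑ ^ 2 * F (hartogsMap p) := by
  have hH := isOpen_hartogsTriangle.measurableSet
  have hFm : Measurable fun p : ℂ × ℂ => ‖p.2‖ₑ ^ 2 * F (hartogsMap p) :=
    Measurable.mul (by fun_prop) (hF.comp continuous_hartogsMap.measurable)
  rw [← lintegral_indicator hH, ← lintegral_indicator measurableSet_bidisc, Measure.volume_eq_prod,
    lintegral_prod_symm' _ (hF.indicator hH),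
    lintegral_prod_symm' _ (hFm.indicator measurableSet_bidisc)]
  refine lintegral_congr fun v => ?_
  by_cases hv : v = 0
  · subst hv
    have h1 : ∀ x : ℂ, ((x, 0) : ℂ × ℂ) ∉ hartogsTriangle := fun x hx =>
      snd_ne_zero_of_mem_hartogsTriangle hx rfl
    simp [indicator, h1]
  · rw [← lintegral_comp_mul_right
      (G := fun x => hartogsTriangle.indicator F (x, v)) ((hF.indicator hH).comp (by fun_prop)) hv,
      ← lintegral_const_mul']
    · refine lintegral_congr fun u => ?_
      have hv' : 0 < ‖v‖ := norm_pos_iff.2 hv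
      have hiff : ((u * v, v) : ℂ × ℂ) ∈ hartogsTriangle ↔ (u, v) ∈ bidisc := by
        simp [hartogsTriangle, bidisc, mul_lt_iff_lt_one_left hv']
      by_cases h : (u, v) ∈ bidisc
      · rw [indicator_of_mem h, indicator_of_mem (hiff.2 h)]; rfl
      · rw [indicator_of_notMem h, indicator_of_notMem (mt hiff.1 h), mul_zero]
    · simp

/-- In this form, Bochner integrals and null sets transfer by the general theory of image measures
and densities. -/
theorem restrict_hartogsTriangle_eq_map :
    volume.restrict hartogsTriangle =
      ((volume.restrict bidisc).withDensity fun p => ((‖p.2‖₊ ^ 2 : ℝ≥0) : ℝ≥0∞)).map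
        hartogsMap := by
  refine Measure.ext_of_lintegral _ fun F hF => ?_
  have hFm : Measurable fun p => F (hartogsMap p) := hF.comp continuous_hartogsMap.measurable
  rw [setLIntegral_hartogsTriangle hF, lintegral_map hF continuous_hartogsMap.measurable,
    lintegral_withDensity_eq_lintegral_mul _ (by fun_prop) hFm]
  refine lintegral_congr fun p => ?_
  simp [enorm_eq_nnnorm]

theorem ae_bidisc_snd_ne_zero : ∀ᵐ p ∂(volume.restrict bidisc), p.2 ≠ 0 := by
  refine ae_restrict_of_ae ?_
  rw [Measure.volume_eq_prod]
  have h : ∀ᵐ v : ℂ, v ≠ 0 := by simp [ae_iff, measure_singleton]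
  exact Measure.quasiMeasurePreserving_snd.ae h

theorem quasiMeasurePreserving_hartogsMap :
    Measure.QuasiMeasurePreserving hartogsMap (volume.restrict bidisc)
      (volume.restrict hartogsTriangle) := by
  refine ⟨continuous_hartogsMap.measurable, ?_⟩
  rw [restrict_hartogsTriangle_eq_map]
  refine Measure.AbsolutelyContinuous.map ?_ continuous_hartogsMap.measurable
  refine withDensity_absolutelyContinuous' (by fun_prop) ?_
  filter_upwards [ae_bidisc_snd_ne_zero] with p hp
  simpa using hp

theorem setLIntegral_hartogsTriangle' {F : ℂ × ℂ → ℝ≥0∞}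
    (hF : AEMeasurable F (volume.restrict hartogsTriangle)) :
    ∫⁻ w in hartogsTriangle, F w = ∫⁻ p in bidisc, ‖p.2‖ₑ ^ 2 * F (hartogsMap p) := by
  rw [lintegral_congr_ae hF.ae_eq_mk, setLIntegral_hartogsTriangle hF.measurable_mk]
  refine lintegral_congr_ae ?_
  filter_upwards [quasiMeasurePreserving_hartogsMap.ae hF.ae_eq_mk] with p hp
  rw [hp]

theorem setIntegral_hartogsTriangle {F : ℂ × ℂ → ℂ}
    (hF : AEStronglyMeasurable F (volume.restrict hartogsTriangle)) :
    ∫ w in hartogsTriangle, F w = ∫ p in bidisc, ((‖p.2‖ ^ 2 : ℝ) : ℂ) * F (hartogsMap p) := by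
  rw [restrict_hartogsTriangle_eq_map] at hF ⊢
  rw [integral_map continuous_hartogsMap.measurable.aemeasurable hF,
    integral_withDensity_eq_integral_smul (by fun_prop)]
  refine integral_congr_ae (Eventually.of_forall fun p => ?_)
  simp [NNReal.smul_def]

theorem restrict_bidisc : (volume : Measure (ℂ × ℂ)).restrict bidisc =
    (volume.restrict (ball 0 1)).prod (volume.restrict (ball 0 1)) := by
  rw [bidisc, Measure.volume_eq_prod, Measure.prod_restrict]

/-! ### Holomorphic dependence of integrals on parameters -/

/-- Only `F` itself has to be dominated: by holomorphy, Cauchy's estimate on a ball of half the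
radius dominates the derivative. -/
theorem differentiableOn_integral_of_bounded_on_balls {α : Type*} [MeasurableSpace α]
    {μ : Measure α} {U : Set (ℂ × ℂ)} (hU : IsOpen U) {F : ℂ × ℂ → α → ℂ}
    (hmeas : ∀ z ∈ U, AEStronglyMeasurable (F z) μ)
    (hdiff : ∀ᵐ w ∂μ, DifferentiableOn ℂ (fun z => F z w) U)
    (hbound : ∀ z₀ ∈ U, ∃ r > 0, ∃ b : α → ℝ, Integrable b μ ∧
      ∀ᵐ w ∂μ, ∀ z ∈ ball z₀ r, ‖F z w‖ ≤ b w) :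
    DifferentiableOn ℂ (fun z => ∫ w, F z w ∂μ) U := by
  intro z₀ hz₀
  obtain ⟨r₁, hr₁, b, hb, hle⟩ := hbound z₀ hz₀
  obtain ⟨r₂, hr₂, hsub⟩ := Metric.isOpen_iff.1 hU z₀ hz₀
  set r := min r₁ r₂ with hr
  have hrpos : 0 < r := lt_min hr₁ hr₂
  have hrU : ball z₀ r ⊆ U := (ball_subset_ball (min_le_right _ _)).trans hsub
  have hle' : ∀ᵐ w ∂μ, ∀ z ∈ ball z₀ r, ‖F z w‖ ≤ b w := hle.mono fun w hw z hz =>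
    hw z (ball_subset_ball (min_le_left _ _) hz)
  refine DifferentiableAt.differentiableWithinAt (HasFDerivAt.differentiableAt
    (f' := ∫ w, fderiv ℂ (fun z => F z w) z₀ ∂μ) ?_)
  refine hasFDerivAt_integral_of_dominated_of_fderiv_le (s := ball z₀ (r / 2))
    (bound := fun w => 2 * b w / (r / 2)) (F' := fun z w => fderiv ℂ (fun z => F z w) z)
    (ball_mem_nhds _ (by positivity)) ?_ ?_ ?_ ?_ ?_ ?_
  · filter_upwards [hU.mem_nhds hz₀] with z hz using hmeas z hz
  · refine hb.mono' (hmeas z₀ hz₀) (hle'.mono fun w hw => hw z₀ (mem_ball_self hrpos))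
  -- Directional derivatives are a.e. limits of difference quotients, which are measurable once the
  -- shift by `N` keeps the points inside `U`. The two coordinate directions then determine the
  -- whole derivative.
  · have hdir : ∀ e : ℂ × ℂ,
        AEStronglyMeasurable (fun w => fderiv ℂ (fun z => F z w) z₀ e) μ := by
      intro e
      have hev : ∀ᶠ n : ℕ in atTop, z₀ + ((n : ℂ))⁻¹ • e ∈ U := by
        have : Tendsto (fun n : ℕ => z₀ + ((n : ℂ))⁻¹ • e) atTop (𝓝 (z₀ + (0 : ℂ) • e)) :=
          tendsto_const_nhds.add ((tendsto_inv_atTop_nhds_zero_nat (𝕜 := ℂ)).smul_const e)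
        rw [zero_smul, add_zero] at this
        exact this.eventually (hU.mem_nhds hz₀)
      obtain ⟨N, hN⟩ := eventually_atTop.1 hev
      refine aestronglyMeasurable_of_tendsto_ae atTop
        (f := fun n w => ((n + N : ℕ) : ℂ) • (F (z₀ + ((n + N : ℕ) : ℂ)⁻¹ • e) w - F z₀ w)) ?_ ?_
      · exact fun n => ((hmeas _ (hN (n + N) (Nat.le_add_left _ _))).sub (hmeas _ hz₀)).const_smul
          ((n + N : ℕ) : ℂ)
      · filter_upwards [hdiff] with w hw
        have h1 := (hw.differentiableAt (hU.mem_nhds hz₀)).hasFDerivAt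
        refine h1.lim e ?_
        simp only [RCLike.norm_natCast]
        exact tendsto_natCast_atTop_atTop.comp (tendsto_add_atTop_nat N)
    have hrepr : (fun w => fderiv ℂ (fun z => F z w) z₀) = fun w =>
        fderiv ℂ (fun z => F z w) z₀ (1, 0) • ContinuousLinearMap.fst ℂ ℂ ℂ +
        fderiv ℂ (fun z => F z w) z₀ (0, 1) • ContinuousLinearMap.snd ℂ ℂ ℂ := by
      ext w <;> simp
    rw [hrepr]
    exact ((hdir _).smul_const _).add ((hdir _).smul_const _)
  · filter_upwards [hle', hdiff] with w hw hdw z hz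
    have hzr : ball z (r / 2) ⊆ ball z₀ r := ball_subset_ball' (by
      rw [mem_ball] at hz; linarith)
    -- On this ball `F` stays within `2 * b w` of its value at the centre.
    refine Complex.norm_fderiv_le_div_of_mapsTo_ball (hdw.mono (hzr.trans hrU)) ?_ (by positivity)
    intro y hy
    rw [mem_closedBall, dist_eq_norm]
    have h1 := hw y (hzr hy)
    have h2 := hw z (hzr (mem_ball_self (by positivity)))
    have h3 := norm_sub_le (F y w) (F z w)
    linarith
  · exact (hb.const_mul 2).div_const _
  · filter_upwards [hdiff] with w hw z hz
    exact (hw.differentiableAt (hU.mem_nhds (hrU (ball_subset_ball (by linarith) hz)))).hasFDerivAt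

/-! ### The explicit kernel -/

/-- The explicit formula for the Bergman kernel of the Hartogs triangle, obtained by transporting
the kernel of the bidisc. -/
noncomputable def hartogsKernel (z w : ℂ × ℂ) : ℂ :=
  ((Real.pi : ℂ) ^ 2)⁻¹ * (z.2 * conj w.2)⁻¹ * ((1 - z.1 / z.2 * conj (w.1 / w.2)) ^ 2)⁻¹ *
    ((1 - z.2 * conj w.2) ^ 2)⁻¹

theorem conj_hartogsKernel (z w : ℂ × ℂ) : conj (hartogsKernel z w) = hartogsKernel w z := by
  simp only [hartogsKernel, map_mul, map_inv₀, map_pow, map_sub, map_one, map_div₀,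
    Complex.conj_conj, Complex.conj_ofReal]
  ring

theorem norm_div_lt_one_of_mem_hartogsTriangle {z : ℂ × ℂ} (hz : z ∈ hartogsTriangle) :
    ‖z.1 / z.2‖ < 1 := by
  rw [norm_div, div_lt_one (norm_pos_iff.2 (snd_ne_zero_of_mem_hartogsTriangle hz))]
  exact hz.1

theorem measurable_hartogsKernel (z : ℂ × ℂ) : Measurable (hartogsKernel z) := by
  unfold hartogsKernel
  have : Measurable (conj : ℂ → ℂ) := Complex.continuous_conj.measurable
  fun_prop

theorem differentiableOn_hartogsKernel {w : ℂ × ℂ} (hw : w ∈ hartogsTriangle) :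
    DifferentiableOn ℂ (fun z => hartogsKernel z w) hartogsTriangle := by
  intro z hz
  have hz2 := snd_ne_zero_of_mem_hartogsTriangle hz
  have hw2 : conj w.2 ≠ 0 := (map_ne_zero _).2 (snd_ne_zero_of_mem_hartogsTriangle hw)
  have h1 := one_sub_mul_conj_ne_zero (norm_div_lt_one_of_mem_hartogsTriangle hz)
    (norm_div_lt_one_of_mem_hartogsTriangle hw)
  have h2 := one_sub_mul_conj_ne_zero hz.2 hw.2
  have h3 : DifferentiableAt ℂ (fun z : ℂ × ℂ => z.1 / z.2) z :=
    (differentiableAt_fst.mul (differentiableAt_snd.inv hz2)).congr_of_eventuallyEq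
      (Eventually.of_forall fun _ => div_eq_mul_inv _ _)
  have d1 : DifferentiableAt ℂ (fun z : ℂ × ℂ => (z.2 * conj w.2)⁻¹) z :=
    DifferentiableAt.inv (by fun_prop) (mul_ne_zero hz2 hw2)
  have d2 : DifferentiableAt ℂ (fun z : ℂ × ℂ =>
      ((1 - z.1 / z.2 * conj (w.1 / w.2)) ^ 2)⁻¹) z :=
    DifferentiableAt.inv (by fun_prop) (pow_ne_zero 2 h1)
  have d3 : DifferentiableAt ℂ (fun z : ℂ × ℂ => ((1 - z.2 * conj w.2) ^ 2)⁻¹) z :=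
    DifferentiableAt.inv (by fun_prop) (pow_ne_zero 2 h2)
  exact (((d1.const_mul _).mul d2).mul d3).differentiableWithinAt

/-- The factor depending on the first variable in the size estimate for the kernel. -/
noncomputable def kernelBound (z : ℂ × ℂ) : ℝ :=
  (Real.pi ^ 2)⁻¹ * ‖z.2‖⁻¹ * ((1 - ‖z.1 / z.2‖) ^ 2)⁻¹ * ((1 - ‖z.2‖) ^ 2)⁻¹

/-- For fixed `z` the kernel is singular in `w` only through `1/|w₂|`, and the constant is locally
bounded in `z`. Integrability of `|f| / |w₂|` therefore gives both convergence and holomorphy of the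
integral. -/
theorem norm_hartogsKernel_le {z w : ℂ × ℂ} (hz : z ∈ hartogsTriangle)
    (hw : w ∈ hartogsTriangle) : ‖hartogsKernel z w‖ ≤ kernelBound z * ‖w.2‖⁻¹ := by
  have h1 := one_sub_norm_le_norm_one_sub_mul_conj (z := z.1 / z.2)
    (norm_div_lt_one_of_mem_hartogsTriangle hw)
  have h2 := one_sub_norm_le_norm_one_sub_mul_conj (z := z.2) hw.2
  have h3 := sub_pos.2 (norm_div_lt_one_of_mem_hartogsTriangle hz)
  have h4 := sub_pos.2 hz.2
  have hpi : ‖(Real.pi : ℂ)‖ = Real.pi := by simp [Real.pi_pos.le]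
  calc ‖hartogsKernel z w‖ = (Real.pi ^ 2)⁻¹ * (‖z.2‖⁻¹ * ‖w.2‖⁻¹) *
        (‖1 - z.1 / z.2 * conj (w.1 / w.2)‖ ^ 2)⁻¹ * (‖1 - z.2 * conj w.2‖ ^ 2)⁻¹ := by
        simp only [hartogsKernel, norm_mul, norm_inv, norm_pow, RCLike.norm_conj, hpi, mul_inv]
    _ ≤ (Real.pi ^ 2)⁻¹ * (‖z.2‖⁻¹ * ‖w.2‖⁻¹) * ((1 - ‖z.1 / z.2‖) ^ 2)⁻¹ *
        ((1 - ‖z.2‖) ^ 2)⁻¹ := by gcongr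
    _ = _ := by rw [kernelBound]; ring

theorem continuousAt_kernelBound {z : ℂ × ℂ} (hz : z ∈ hartogsTriangle) :
    ContinuousAt kernelBound z := by
  have hz2 := snd_ne_zero_of_mem_hartogsTriangle hz
  have h3 := (sub_pos.2 (norm_div_lt_one_of_mem_hartogsTriangle hz)).ne'
  have h4 := (sub_pos.2 hz.2).ne'
  have h5 : ContinuousAt (fun z : ℂ × ℂ => z.1 / z.2) z :=
    continuousAt_fst.div continuousAt_snd hz2
  have c1 : ContinuousAt (fun z : ℂ × ℂ => ‖z.2‖⁻¹) z :=
    ContinuousAt.inv₀ (by fun_prop) (norm_ne_zero_iff.2 hz2)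
  have c2 : ContinuousAt (fun z : ℂ × ℂ => ((1 - ‖z.1 / z.2‖) ^ 2)⁻¹) z :=
    ContinuousAt.inv₀ (by fun_prop) (pow_ne_zero 2 h3)
  have c3 : ContinuousAt (fun z : ℂ × ℂ => ((1 - ‖z.2‖) ^ 2)⁻¹) z :=
    ContinuousAt.inv₀ (by fun_prop) (pow_ne_zero 2 h4)
  exact ((continuousAt_const.mul c1).mul c2).mul c3

theorem ae_mem_hartogsTriangle : ∀ᵐ w ∂(volume.restrict hartogsTriangle), w ∈ hartogsTriangle :=
  ae_restrict_mem isOpen_hartogsTriangle.measurableSet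

theorem integrable_hartogsKernel_mul {f : ℂ × ℂ → ℂ}
    (hf : AEStronglyMeasurable f (volume.restrict hartogsTriangle))
    (hfi : Integrable (fun w => ‖w.2‖⁻¹ * ‖f w‖) (volume.restrict hartogsTriangle))
    {z : ℂ × ℂ} (hz : z ∈ hartogsTriangle) :
    Integrable (fun w => hartogsKernel z w * f w) (volume.restrict hartogsTriangle) := by
  refine (hfi.const_mul (kernelBound z)).mono'
    ((measurable_hartogsKernel z).aestronglyMeasurable.mul hf) ?_
  filter_upwards [ae_mem_hartogsTriangle] with w hw
  rw [norm_mul, ← mul_assoc]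
  gcongr
  exact norm_hartogsKernel_le hz hw

theorem differentiableOn_kernelOperator {f : ℂ × ℂ → ℂ}
    (hf : AEStronglyMeasurable f (volume.restrict hartogsTriangle))
    (hfi : Integrable (fun w => ‖w.2‖⁻¹ * ‖f w‖) (volume.restrict hartogsTriangle)) :
    DifferentiableOn ℂ (kernelOperator hartogsTriangle hartogsKernel f) hartogsTriangle := by
  refine differentiableOn_integral_of_bounded_on_balls isOpen_hartogsTriangle
    (fun z _ => (measurable_hartogsKernel z).aestronglyMeasurable.mul hf) ?_ fun z₀ hz₀ => ?_
  · filter_upwards [ae_mem_hartogsTriangle] with w hw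
    exact (differentiableOn_hartogsKernel hw).mul_const _
  · have hev := ((continuousAt_kernelBound hz₀).eventually_lt_const (lt_add_one _)).and
      (isOpen_hartogsTriangle.mem_nhds hz₀)
    obtain ⟨r, hr, hball⟩ := Metric.eventually_nhds_iff_ball.1 hev
    refine ⟨r, hr, _, hfi.const_mul (kernelBound z₀ + 1), ?_⟩
    filter_upwards [ae_mem_hartogsTriangle] with w hw z hz
    rw [norm_mul, ← mul_assoc]
    gcongr
    refine (norm_hartogsKernel_le (hball z hz).2 hw).trans ?_
    gcongr
    exact (hball z hz).1.le

/-- The Jacobian `|v|²` cancels `|v|^(-2)`, leaving the finite volume of the bidisc. -/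
theorem memLp_inv_norm_snd :
    MemLp (fun w : ℂ × ℂ => ‖w.2‖⁻¹) 2 (volume.restrict hartogsTriangle) := by
  refine ⟨Measurable.aestronglyMeasurable (by fun_prop), ?_⟩
  rw [eLpNorm_lt_top_iff_lintegral_rpow_enorm_lt_top (by simp) (by simp),
    setLIntegral_hartogsTriangle (by fun_prop)]
  have hb : volume bidisc < ∞ := by
    rw [bidisc, Measure.volume_eq_prod, Measure.prod_prod]
    exact ENNReal.mul_lt_top measure_ball_lt_top measure_ball_lt_top
  refine lt_of_le_of_lt (b := ∫⁻ p in bidisc, 1) (lintegral_mono fun p => ?_) (by simpa using hb)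
  rcases eq_or_ne p.2 0 with h | h
  · simp [h]
  · have h' : ‖p.2‖ₑ ≠ 0 := by simpa using h
    have h2 : ‖‖p.2‖⁻¹‖ₑ = ‖p.2‖ₑ⁻¹ := by rw [enorm_inv (by simpa using h), enorm_norm]
    simp only [hartogsMap, h2, ENNReal.toReal_ofNat, ENNReal.rpow_ofNat]
    rw [← mul_pow, ENNReal.mul_inv_cancel h' enorm_ne_top, one_pow]

theorem integrable_inv_norm_snd_mul {f : ℂ × ℂ → ℂ}
    (hf : MemLp f 2 (volume.restrict hartogsTriangle)) :
    Integrable (fun w => ‖w.2‖⁻¹ * ‖f w‖) (volume.restrict hartogsTriangle) :=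
  memLp_inv_norm_snd.integrable_mul hf.norm

theorem hartogsKernel_mem_bergmanSpace {z : ℂ × ℂ} (hz : z ∈ hartogsTriangle) :
    (fun w => conj (hartogsKernel z w)) ∈ bergmanSpace hartogsTriangle := by
  refine ⟨?_, ?_⟩
  · simp only [conj_hartogsKernel]
    exact differentiableOn_hartogsKernel hz
  · refine (memLp_inv_norm_snd.const_mul (kernelBound z)).mono
      (Complex.continuous_conj.measurable.comp
        (measurable_hartogsKernel z)).aestronglyMeasurable ?_
    filter_upwards [ae_mem_hartogsTriangle] with w hw
    rw [RCLike.norm_conj]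
    exact (norm_hartogsKernel_le hz hw).trans (le_abs_self _)

instance isFiniteMeasure_restrict_ball :
    IsFiniteMeasure ((volume : Measure ℂ).restrict (ball 0 1)) :=
  isFiniteMeasure_restrict.2 measure_ball_lt_top.ne

/-! ### The reproducing property on the Hartogs triangle -/

/-- Needed to carry almost-everywhere statements from the bidisc back to the triangle. -/
theorem quasiMeasurePreserving_hartogsMap_inv :
    Measure.QuasiMeasurePreserving (fun z : ℂ × ℂ => (z.1 / z.2, z.2))
      (volume.restrict hartogsTriangle) (volume.restrict bidisc) := by
  have hm : Measurable fun z : ℂ × ℂ => (z.1 / z.2, z.2) := by fun_prop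
  refine ⟨hm, ?_⟩
  rw [restrict_hartogsTriangle_eq_map, Measure.map_map hm continuous_hartogsMap.measurable]
  have hac := withDensity_absolutelyContinuous (volume.restrict bidisc)
    fun p : ℂ × ℂ => ((‖p.2‖₊ ^ 2 : ℝ≥0) : ℝ≥0∞)
  rw [Measure.map_congr (g := id), Measure.map_id]
  · exact hac
  · refine hac.ae_le ?_
    filter_upwards [ae_bidisc_snd_ne_zero] with p hp
    simp [hartogsMap, hp]

theorem ae_hartogsTriangle_of_ae_bidisc {Q : ℂ × ℂ → Prop}
    (h : ∀ᵐ p ∂(volume.restrict bidisc), Q (hartogsMap p)) :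
    ∀ᵐ z ∂(volume.restrict hartogsTriangle), Q z := by
  filter_upwards [quasiMeasurePreserving_hartogsMap_inv.ae h, ae_mem_hartogsTriangle] with z hz hzH
  have : hartogsMap (z.1 / z.2, z.2) = z := by
    simp [hartogsMap, div_mul_cancel₀ _ (snd_ne_zero_of_mem_hartogsTriangle hzH)]
  rwa [this] at hz

/-- The pullback of a function on the Hartogs triangle to the bidisc, weighted by the complex
Jacobian. -/
noncomputable def bidiscPullback (f : ℂ × ℂ → ℂ) (p : ℂ × ℂ) : ℂ := p.2 * f (hartogsMap p)

theorem aestronglyMeasurable_bidiscPullback {f : ℂ × ℂ → ℂ}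
    (hf : AEStronglyMeasurable f (volume.restrict hartogsTriangle)) :
    AEStronglyMeasurable (bidiscPullback f) (volume.restrict bidisc) :=
  continuous_snd.aestronglyMeasurable.mul
    (hf.comp_quasiMeasurePreserving quasiMeasurePreserving_hartogsMap)

/-- Write the Jacobian as `q.2 * conj q.2`: the conjugate cancels the pole of the kernel and `q.2`
is absorbed into the pullback. -/
theorem hartogsKernel_hartogsMap {p q : ℂ × ℂ} (hp : p.2 ≠ 0) (hq : q.2 ≠ 0) (c : ℂ) :
    ((‖q.2‖ ^ 2 : ℝ) : ℂ) * (hartogsKernel (hartogsMap p) (hartogsMap q) * c) =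
      ((Real.pi : ℂ) ^ 2 * p.2)⁻¹ * (((1 - p.1 * conj q.1) ^ 2)⁻¹ *
        ((q.2 * c) * ((1 - p.2 * conj q.2) ^ 2)⁻¹)) := by
  have h : ((‖q.2‖ ^ 2 : ℝ) : ℂ) = q.2 * conj q.2 := by rw [Complex.mul_conj']; push_cast; rfl
  have hq' : conj q.2 ≠ 0 := (map_ne_zero _).2 hq
  rw [h]
  simp only [hartogsKernel, hartogsMap, mul_div_cancel_right₀ _ hp, mul_div_cancel_right₀ _ hq,
    mul_inv]
  have hqq : conj q.2 * (conj q.2)⁻¹ = 1 := mul_inv_cancel₀ hq'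
  linear_combination (((Real.pi : ℂ) ^ 2)⁻¹ * p.2⁻¹ * ((1 - p.1 * conj q.1) ^ 2)⁻¹ *
        ((q.2 * c) * ((1 - p.2 * conj q.2) ^ 2)⁻¹)) * hqq

theorem kernelOperator_hartogsMap {f : ℂ × ℂ → ℂ}
    (hf : AEStronglyMeasurable f (volume.restrict hartogsTriangle)) {p : ℂ × ℂ} (hp : p.2 ≠ 0) :
    kernelOperator hartogsTriangle hartogsKernel f (hartogsMap p) =
      ((Real.pi : ℂ) ^ 2 * p.2)⁻¹ * ∫ q in bidisc, ((1 - p.1 * conj q.1) ^ 2)⁻¹ *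
        (bidiscPullback f q * ((1 - p.2 * conj q.2) ^ 2)⁻¹) := by
  have hm : AEStronglyMeasurable (fun w => hartogsKernel (hartogsMap p) w * f w)
      (volume.restrict hartogsTriangle) :=
    (measurable_hartogsKernel _).aestronglyMeasurable.mul hf
  rw [kernelOperator, setIntegral_hartogsTriangle hm, ← integral_const_mul]
  refine integral_congr_ae ?_
  filter_upwards [ae_bidisc_snd_ne_zero] with q hq
  exact hartogsKernel_hartogsMap hp hq _

theorem memLp_bidiscPullback {f : ℂ × ℂ → ℂ} (hf : MemLp f 2 (volume.restrict hartogsTriangle)) :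
    MemLp (bidiscPullback f) 2 (volume.restrict bidisc) := by
  refine ⟨aestronglyMeasurable_bidiscPullback hf.1, ?_⟩
  have h := (eLpNorm_lt_top_iff_lintegral_rpow_enorm_lt_top (by simp) (by simp)).1
    hf.eLpNorm_lt_top
  rw [setLIntegral_hartogsTriangle' (hf.1.enorm.pow_const _)] at h
  rw [eLpNorm_lt_top_iff_lintegral_rpow_enorm_lt_top (by simp) (by simp)]
  refine lt_of_le_of_lt (le_of_eq (lintegral_congr fun p => ?_)) h
  simp [bidiscPullback, mul_pow]

theorem ae_memLp_two_slices {α β : Type*} [MeasurableSpace α] [MeasurableSpace β] {μ : Measure α}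
    {ν : Measure β} [SFinite μ] [SFinite ν] {G : α × β → ℂ} (hG : MemLp G 2 (μ.prod ν)) :
    (∀ᵐ x ∂μ, MemLp (fun y => G (x, y)) 2 ν) := by
  have h1 := hG.1.prodMk_left
  have h2 := ((memLp_two_iff_integrable_sq_norm hG.1).1 hG).prod_right_ae
  filter_upwards [h1, h2] with x hx1 hx2
  exact (memLp_two_iff_integrable_sq_norm hx1).2 hx2

/-- The reproducing property of the disc is used in one variable at a time, first in `v` and then in
`u`. It is claimed only almost everywhere because the slices are known to be `L²` only almost
everywhere, and because the disc lemma excludes the centre. -/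
theorem ae_kernelOperator_eq_self {g : ℂ × ℂ → ℂ} (hg : g ∈ bergmanSpace hartogsTriangle) :
    ∀ᵐ z ∂(volume.restrict hartogsTriangle),
      kernelOperator hartogsTriangle hartogsKernel g z = g z := by
  have hG := memLp_bidiscPullback hg.2
  rw [restrict_bidisc] at hG
  have hslice1 := ae_memLp_two_slices hG
  have hslice2 := ae_memLp_two_slices (G := bidiscPullback g ∘ Prod.swap)
    (hG.comp_measurePreserving Measure.measurePreserving_swap)
  have hae2 : ∀ᵐ p ∂(volume.restrict bidisc),
      MemLp (fun u => bidiscPullback g (u, p.2)) 2 (volume.restrict (ball 0 1)) := by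
    rw [restrict_bidisc]
    exact Measure.quasiMeasurePreserving_snd.ae hslice2
  have hae1 : ∀ᵐ p ∂(volume.restrict bidisc), p.1 ≠ 0 := by
    refine ae_restrict_of_ae ?_
    rw [Measure.volume_eq_prod]
    have h : ∀ᵐ v : ℂ, v ≠ 0 := by simp [ae_iff, measure_singleton]
    exact Measure.quasiMeasurePreserving_fst.ae h
  refine ae_hartogsTriangle_of_ae_bidisc ?_
  filter_upwards [hae1, hae2, ae_bidisc_snd_ne_zero, ae_restrict_mem measurableSet_bidisc]
    with p hp1 hpL hp2 hp
  have hp1' : ‖p.1‖ < 1 := by simpa using hp.1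
  have hp2' : ‖p.2‖ < 1 := by simpa using hp.2
  have hk1 : MemLp (fun q : ℂ × ℂ => ((1 - p.1 * conj q.1) ^ 2)⁻¹) ⊤
      ((volume.restrict (ball 0 1)).prod (volume.restrict (ball (0 : ℂ) 1))) :=
    (memLp_discKernel hp1' ⊤).comp_fst _
  have hk2 : MemLp (fun q : ℂ × ℂ => ((1 - p.2 * conj q.2) ^ 2)⁻¹) 2
      ((volume.restrict (ball (0 : ℂ) 1)).prod (volume.restrict (ball 0 1))) :=
    (memLp_discKernel hp2' 2).comp_snd _
  have hint : Integrable (fun q : ℂ × ℂ => ((1 - p.1 * conj q.1) ^ 2)⁻¹ *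
      (bidiscPullback g q * ((1 - p.2 * conj q.2) ^ 2)⁻¹))
      ((volume.restrict (ball 0 1)).prod (volume.restrict (ball (0 : ℂ) 1))) :=
    Integrable.mul_of_top_right (hG.integrable_mul hk2) hk1
  rw [kernelOperator_hartogsMap hg.2.1 hp2, restrict_bidisc, integral_prod _ hint]
  have hinner : ∀ᵐ u ∂(volume.restrict (ball (0 : ℂ) 1)),
      ∫ v in ball (0 : ℂ) 1, ((1 - p.1 * conj u) ^ 2)⁻¹ *
        (bidiscPullback g (u, v) * ((1 - p.2 * conj v) ^ 2)⁻¹) =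
      Real.pi * (bidiscPullback g (u, p.2) * ((1 - p.1 * conj u) ^ 2)⁻¹) := by
    filter_upwards [hslice1, ae_restrict_mem measurableSet_ball] with u hu hu1
    have hd : DifferentiableOn ℂ (fun v => bidiscPullback g (u, v)) (ball 0 1 \ {0}) := by
      refine differentiableOn_id.mul (hg.1.comp (f := fun v => hartogsMap (u, v)) ?_ ?_)
      · unfold hartogsMap; fun_prop
      · exact fun v hv => hartogsMap_mem ⟨hu1, hv.1⟩ hv.2
    rw [integral_const_mul, integral_mul_discKernel hd hu hp2' hp2]
    ring
  have hd : DifferentiableOn ℂ (fun u => bidiscPullback g (u, p.2)) (ball 0 1 \ {0}) := by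
    refine (differentiableOn_const p.2).mul
      (hg.1.comp (f := fun u => hartogsMap (u, p.2)) ?_ ?_)
    · unfold hartogsMap; fun_prop
    · exact fun u hu => hartogsMap_mem ⟨hu.1, hp.2⟩ hp2
  rw [integral_congr_ae hinner, integral_const_mul, integral_mul_discKernel hd hpL hp1' hp1]
  have hpi : (Real.pi : ℂ) ≠ 0 := by exact_mod_cast Real.pi_ne_zero
  change _ * (_ * (_ * (p.2 * g (hartogsMap p)))) = _
  field_simp

/-! ### Existence of the Bergman kernel -/

/-- The Bergman space as a submodule of `L²`. -/
noncomputable def bergmanSubmodule (Ω : Set (ℂ × ℂ)) :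
    Submodule ℂ (Lp ℂ 2 (volume.restrict Ω)) where
  carrier := {F | ∃ g ∈ bergmanSpace Ω, F =ᵐ[volume.restrict Ω] g}
  add_mem' := by
    rintro F F' ⟨g, hg, hF⟩ ⟨g', hg', hF'⟩
    exact ⟨g + g', ⟨hg.1.add hg'.1, hg.2.add hg'.2⟩,
      (Lp.coeFn_add F F').trans (hF.add hF')⟩
  zero_mem' := ⟨0, ⟨differentiableOn_const 0, MemLp.zero⟩, Lp.coeFn_zero _ _ _⟩
  smul_mem' := by
    rintro c F ⟨g, hg, hF⟩
    exact ⟨c • g, ⟨hg.1.const_smul c, hg.2.const_smul c⟩,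
      (Lp.coeFn_smul c F).trans (hF.const_smul c)⟩

theorem toLp_mem_bergmanSubmodule {Ω : Set (ℂ × ℂ)} {g : ℂ × ℂ → ℂ} (hg : g ∈ bergmanSpace Ω) :
    hg.2.toLp g ∈ bergmanSubmodule Ω := ⟨g, hg, hg.2.coeFn_toLp⟩

theorem inner_toLp_eq_integral {Ω : Set (ℂ × ℂ)} {h : ℂ × ℂ → ℂ}
    (hh : MemLp h 2 (volume.restrict Ω)) {X : Lp ℂ 2 (volume.restrict Ω)} {x : ℂ × ℂ → ℂ}
    (hx : X =ᵐ[volume.restrict Ω] x) :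
    inner ℂ (hh.toLp h) X = ∫ w in Ω, x w * conj (h w) := by
  rw [L2.inner_def]
  refine integral_congr_ae ?_
  filter_upwards [hh.coeFn_toLp, hx] with w h1 h2
  rw [h1, h2, RCLike.inner_apply]

/-- Closedness of the Bergman space is not presupposed. Project `f` to `G` in the closure and
approximate `G` by `g n` in the space. Pairing with the kernel gives the same value on `f` and on
`G`, and that value is the limit of `g n z`; along a subsequence this limit is also `G z` almost
everywhere. So `G` has the holomorphic representative `P f`. -/
theorem isBergmanKernel_hartogsKernel : IsBergmanKernel hartogsTriangle hartogsKernel := by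
  refine ⟨fun z hz => hartogsKernel_mem_bergmanSpace hz, fun f hf => ?_⟩
  set V := (bergmanSubmodule hartogsTriangle).topologicalClosure with hV
  have : CompleteSpace V :=
    (bergmanSubmodule hartogsTriangle).isClosed_topologicalClosure.completeSpace_coe
  set F := hf.toLp f with hF
  set G := V.starProjection F with hG
  have hGV : G ∈ V := Submodule.starProjection_apply_mem _ _
  have horth : ∀ h (hh : h ∈ bergmanSpace hartogsTriangle),
      inner ℂ (hh.2.toLp h) (F - G) = 0 := fun h hh =>
    (Submodule.mem_orthogonal _ _).1 (Submodule.sub_starProjection_mem_orthogonal F) _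
      (subset_closure (toLp_mem_bergmanSubmodule hh))
  obtain ⟨X, hXmem, hXlim⟩ := mem_closure_iff_seq_limit.1 hGV
  choose g hgmem hXg using hXmem
  obtain ⟨ns, hns, hae⟩ := (tendstoInMeasure_of_tendsto_Lp hXlim).exists_seq_tendsto_ae
  have hPf : ∀ z ∈ hartogsTriangle, ∀ Y : Lp ℂ 2 (volume.restrict hartogsTriangle),
      ∀ y : ℂ × ℂ → ℂ, Y =ᵐ[volume.restrict hartogsTriangle] y → ∀ hk,
      inner ℂ (MemLp.toLp (fun w => conj (hartogsKernel z w)) hk) Y =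
        kernelOperator hartogsTriangle hartogsKernel y z := by
    intro z hz Y y hy hk
    rw [inner_toLp_eq_integral hk hy, kernelOperator]
    simp only [Complex.conj_conj, mul_comm]
  have hPG : kernelOperator hartogsTriangle hartogsKernel f =ᵐ[volume.restrict hartogsTriangle]
      G := by
    have hrep : ∀ᵐ z ∂(volume.restrict hartogsTriangle), ∀ n,
        kernelOperator hartogsTriangle hartogsKernel (g n) z = g n z :=
      ae_all_iff.2 fun n => ae_kernelOperator_eq_self (hgmem n)
    filter_upwards [hae, hrep, ae_all_iff.2 hXg, ae_mem_hartogsTriangle] with z h1 h2 h3 hz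
    have hk := (hartogsKernel_mem_bergmanSpace hz).2
    have hlim : Tendsto (fun n => inner ℂ (hk.toLp _) (X n)) atTop (𝓝 (inner ℂ (hk.toLp _) G)) :=
      tendsto_const_nhds.inner hXlim
    have hlim' : Tendsto (fun n => g n z) atTop
        (𝓝 (kernelOperator hartogsTriangle hartogsKernel f z)) := by
      -- The conjugated kernel lies in the Bergman space, so it is orthogonal to `F - G`.
      have h4 := horth _ (hartogsKernel_mem_bergmanSpace hz)
      rw [inner_sub_right, sub_eq_zero, hPf z hz F f hf.coeFn_toLp] at h4
      rw [h4]
      refine hlim.congr fun n => ?_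
      rw [hPf z hz (X n) (g n) (hXg n), h2 n]
    refine tendsto_nhds_unique (hlim'.comp hns.tendsto_atTop) ?_
    simpa only [Function.comp_def, h3] using h1
  have hmem : kernelOperator hartogsTriangle hartogsKernel f ∈ bergmanSpace hartogsTriangle :=
    ⟨differentiableOn_kernelOperator hf.1 (integrable_inv_norm_snd_mul hf),
      (Lp.memLp G).ae_eq hPG.symm⟩
  refine ⟨hmem, fun h hh => ?_⟩
  rw [← horth h hh, inner_toLp_eq_integral hh.2
    ((Lp.coeFn_sub F G).trans (hf.coeFn_toLp.sub hPG.symm))]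
  rfl

/-- Here `f - g` lies in the Bergman space and is orthogonal to itself; continuity upgrades a.e.
equality to equality on the open set. -/
theorem IsOrthogonalProjectionToBergmanSpace.eqOn_of_mem {Ω : Set (ℂ × ℂ)} (hΩ : IsOpen Ω)
    {f g : ℂ × ℂ → ℂ} (h : IsOrthogonalProjectionToBergmanSpace Ω f g)
    (hf : f ∈ bergmanSpace Ω) : EqOn f g Ω := by
  have hsub : f - g ∈ bergmanSpace Ω := ⟨hf.1.sub h.1.1, hf.2.sub h.1.2⟩
  refine Measure.eqOn_open_of_ae_eq (μ := volume) ?_ hΩ hf.1.continuousOn h.1.1.continuousOn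
  have h0 := h.2 _ hsub
  have h1 : (inner ℂ (hsub.2.toLp (f - g)) (hsub.2.toLp (f - g)) : ℂ) = 0 := by
    rw [inner_toLp_eq_integral hsub.2 hsub.2.coeFn_toLp]; exact h0
  have h2 := (Lp.eq_zero_iff_ae_eq_zero.1 (inner_self_eq_zero.1 h1))
  filter_upwards [h2, hsub.2.coeFn_toLp] with w hw1 hw2
  rw [hw1] at hw2
  exact (sub_eq_zero.1 hw2.symm)

/-- Both kernels reproduce `d = conj K(z, ·) - conj K'(z, ·)` at `z`; subtracting the two identities
gives `‖d‖² = 0`. -/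
theorem IsBergmanKernel.ae_eq {Ω : Set (ℂ × ℂ)} (hΩ : IsOpen Ω) {K K' : ℂ × ℂ → ℂ × ℂ → ℂ}
    (hK : IsBergmanKernel Ω K) (hK' : IsBergmanKernel Ω K') {z : ℂ × ℂ} (hz : z ∈ Ω) :
    K z =ᵐ[volume.restrict Ω] K' z := by
  have hk := hK.conj_mem z hz
  have hk' := hK'.conj_mem z hz
  have hsub : (fun w => conj (K z w)) - (fun w => conj (K' z w)) ∈ bergmanSpace Ω :=
    ⟨hk.1.sub hk'.1, hk.2.sub hk'.2⟩
  have e1 := (hK.projection _ hsub.2).eqOn_of_mem hΩ hsub hz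
  have e2 := (hK'.projection _ hsub.2).eqOn_of_mem hΩ hsub hz
  have h1 : (inner ℂ (hsub.2.toLp _) (hsub.2.toLp _) : ℂ) = 0 := by
    have i1 := inner_toLp_eq_integral hk.2 hsub.2.coeFn_toLp
    have i2 := inner_toLp_eq_integral hk'.2 hsub.2.coeFn_toLp
    rw [MemLp.toLp_sub hk.2 hk'.2, inner_sub_left, ← MemLp.toLp_sub hk.2 hk'.2, i1, i2,
      sub_eq_zero]
    simp only [Complex.conj_conj]
    simp only [kernelOperator, mul_comm (K z _), mul_comm (K' z _)] at e1 e2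
    exact e1.symm.trans e2
  have h2 := (Lp.eq_zero_iff_ae_eq_zero.1 (inner_self_eq_zero.1 h1))
  filter_upwards [h2, hsub.2.coeFn_toLp] with w hw1 hw2
  rw [hw1] at hw2
  exact (starRingEnd ℂ).injective (sub_eq_zero.1 hw2.symm)

theorem isBergmanKernel_bergmanKernel_hartogsTriangle :
    IsBergmanKernel hartogsTriangle (bergmanKernel hartogsTriangle) :=
  Classical.epsilon_spec ⟨_, isBergmanKernel_hartogsKernel⟩

theorem bergmanKernel_hartogsTriangle_ae_eq {z : ℂ × ℂ} (hz : z ∈ hartogsTriangle) :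
    bergmanKernel hartogsTriangle z =ᵐ[volume.restrict hartogsTriangle] hartogsKernel z :=
  isBergmanKernel_bergmanKernel_hartogsTriangle.ae_eq isOpen_hartogsTriangle
    isBergmanKernel_hartogsKernel hz

theorem bergmanProjection_hartogsTriangle_eq {z : ℂ × ℂ} (hz : z ∈ hartogsTriangle)
    (f : ℂ × ℂ → ℂ) : bergmanProjection hartogsTriangle f z =
      kernelOperator hartogsTriangle hartogsKernel f z := by
  refine integral_congr_ae ?_
  filter_upwards [bergmanKernel_hartogsTriangle_ae_eq hz] with w hw
  rw [hw]

/-! ### Schur's test -/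

/-- Split `k f` as `(k^(1/p) f / h) (k^(1/q) h)` and apply Hölder in `y`. The second factor is
controlled by `h₁`; after Tonelli the first is controlled by `h₂`. -/
theorem lintegral_rpow_le_of_schur {α : Type*} [MeasurableSpace α] {μ : Measure α} [SFinite μ]
    {p q : ℝ} (hpq : p.HolderConjugate q) {k : α → α → ℝ≥0∞} (hk : Measurable (Function.uncurry k))
    {h : α → ℝ≥0∞} (hh : Measurable h) (hh0 : ∀ᵐ x ∂μ, h x ≠ 0) (hht : ∀ᵐ x ∂μ, h x ≠ ∞)
    {C₁ C₂ : ℝ≥0∞} (h₁ : ∀ᵐ x ∂μ, ∫⁻ y, k x y * h y ^ q ∂μ ≤ C₁ * h x ^ q)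
    (h₂ : ∀ᵐ y ∂μ, ∫⁻ x, k x y * h x ^ p ∂μ ≤ C₂ * h y ^ p)
    {f : α → ℝ≥0∞} (hf : Measurable f) :
    ∫⁻ x, (∫⁻ y, k x y * f y ∂μ) ^ p ∂μ ≤ C₁ ^ (p / q) * C₂ * ∫⁻ y, f y ^ p ∂μ := by
  have hp0 := hpq.pos
  have hq0 := hpq.symm.pos
  have hkx : ∀ x, Measurable (k x) := fun x => hk.comp (measurable_prodMk_left)
  have hky : ∀ y, Measurable (fun x => k x y) := fun y => hk.comp (measurable_prodMk_right)
  have hsum : p⁻¹ + q⁻¹ = 1 := hpq.inv_add_inv_eq_one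
  have step : ∀ᵐ x ∂μ, (∫⁻ y, k x y * f y ∂μ) ^ p ≤
      C₁ ^ (p / q) * (h x ^ p * ∫⁻ y, k x y * (f y * (h y)⁻¹) ^ p ∂μ) := by
    filter_upwards [h₁] with x hx
    have e1 : ∫⁻ y, k x y * f y ∂μ =
        ∫⁻ y, ((fun y => k x y ^ p⁻¹ * (f y * (h y)⁻¹)) * fun y => k x y ^ q⁻¹ * h y) y ∂μ := by
      refine lintegral_congr_ae ?_
      filter_upwards [hh0, hht] with y hy0 hyt
      simp only [Pi.mul_apply]
      calc k x y * f y = k x y ^ (p⁻¹ + q⁻¹) * f y * ((h y)⁻¹ * h y) := by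
            rw [hsum, ENNReal.rpow_one, ENNReal.inv_mul_cancel hy0 hyt, mul_one]
        _ = _ := by
            rw [ENNReal.rpow_add_of_nonneg _ _ (by positivity) (by positivity)]; ring
    have e2 := ENNReal.lintegral_mul_le_Lp_mul_Lq μ hpq
      (f := fun y => k x y ^ p⁻¹ * (f y * (h y)⁻¹)) (g := fun y => k x y ^ q⁻¹ * h y)
      (((hkx x).pow_const _).mul (hf.mul hh.inv)).aemeasurable
      (((hkx x).pow_const _).mul hh).aemeasurable
    rw [← e1] at e2
    have e3 : ∀ y, (k x y ^ p⁻¹ * (f y * (h y)⁻¹)) ^ p = k x y * (f y * (h y)⁻¹) ^ p := fun y => by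
      rw [ENNReal.mul_rpow_of_nonneg _ _ hp0.le, ← ENNReal.rpow_mul, inv_mul_cancel₀ hp0.ne',
        ENNReal.rpow_one]
    have e4 : ∀ y, (k x y ^ q⁻¹ * h y) ^ q = k x y * h y ^ q := fun y => by
      rw [ENNReal.mul_rpow_of_nonneg _ _ hq0.le, ← ENNReal.rpow_mul, inv_mul_cancel₀ hq0.ne',
        ENNReal.rpow_one]
    simp only [e3, e4] at e2
    calc (∫⁻ y, k x y * f y ∂μ) ^ p
        ≤ ((∫⁻ y, k x y * (f y * (h y)⁻¹) ^ p ∂μ) ^ (1 / p) * (C₁ * h x ^ q) ^ (1 / q)) ^ p := by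
          refine ENNReal.rpow_le_rpow (e2.trans ?_) hp0.le
          gcongr
      _ = C₁ ^ (p / q) * (h x ^ p * ∫⁻ y, k x y * (f y * (h y)⁻¹) ^ p ∂μ) := by
          rw [ENNReal.mul_rpow_of_nonneg _ _ hp0.le, ← ENNReal.rpow_mul, ← ENNReal.rpow_mul,
            one_div_mul_cancel hp0.ne', ENNReal.rpow_one, one_div_mul_eq_div,
            ENNReal.mul_rpow_of_nonneg _ _ (by positivity), ← ENNReal.rpow_mul,
            mul_div_cancel₀ _ hq0.ne']
          ring
  have hg : Measurable fun y => (f y * (h y)⁻¹) ^ p := (hf.mul hh.inv).pow_const _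
  calc ∫⁻ x, (∫⁻ y, k x y * f y ∂μ) ^ p ∂μ
      ≤ ∫⁻ x, C₁ ^ (p / q) * (h x ^ p * ∫⁻ y, k x y * (f y * (h y)⁻¹) ^ p ∂μ) ∂μ :=
        lintegral_mono_ae step
    _ = C₁ ^ (p / q) * ∫⁻ x, ∫⁻ y, h x ^ p * (k x y * (f y * (h y)⁻¹) ^ p) ∂μ ∂μ := by
        have hm : Measurable fun x => ∫⁻ y, k x y * (f y * (h y)⁻¹) ^ p ∂μ :=
          Measurable.lintegral_prod_right' (f := fun z : α × α => k z.1 z.2 *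
            (f z.2 * (h z.2)⁻¹) ^ p) (hk.mul (hg.comp measurable_snd))
        have hm' : Measurable fun x => h x ^ p * ∫⁻ y, k x y * (f y * (h y)⁻¹) ^ p ∂μ :=
          (hh.pow_const p).mul hm
        rw [lintegral_const_mul _ hm']
        congr 1
        refine lintegral_congr fun x => ?_
        have hmx : Measurable fun y => k x y * (f y * (h y)⁻¹) ^ p := (hkx x).mul hg
        rw [lintegral_const_mul _ hmx]
    _ = C₁ ^ (p / q) * ∫⁻ y, ∫⁻ x, h x ^ p * (k x y * (f y * (h y)⁻¹) ^ p) ∂μ ∂μ := by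
        rw [lintegral_lintegral_swap]
        exact (((hh.comp measurable_fst).pow_const p).mul
          (hk.mul (hg.comp measurable_snd))).aemeasurable
    _ ≤ C₁ ^ (p / q) * ∫⁻ y, C₂ * f y ^ p ∂μ := by
        refine mul_le_mul_right (lintegral_mono_ae ?_) _
        filter_upwards [h₂, hh0, hht] with y hy hy0 hyt
        have hm : Measurable fun x => k x y * h x ^ p := (hky y).mul (hh.pow_const p)
        calc ∫⁻ x, h x ^ p * (k x y * (f y * (h y)⁻¹) ^ p) ∂μ
            = (f y * (h y)⁻¹) ^ p * ∫⁻ x, k x y * h x ^ p ∂μ := by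
              rw [← lintegral_const_mul _ hm]
              exact lintegral_congr fun x => by ring
          _ ≤ (f y * (h y)⁻¹) ^ p * (C₂ * h y ^ p) := by gcongr
          _ = C₂ * (f y * ((h y)⁻¹ * h y)) ^ p := by
              rw [← mul_assoc (f y), ENNReal.mul_rpow_of_nonneg (f y * (h y)⁻¹) _ hp0.le]; ring
          _ = C₂ * f y ^ p := by rw [ENNReal.inv_mul_cancel hy0 hyt, mul_one]
    _ = C₁ ^ (p / q) * C₂ * ∫⁻ y, f y ^ p ∂μ := by
        rw [lintegral_const_mul _ (hf.pow_const p), mul_assoc]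

/-! ### The absolute value of the Bergman kernel of the disc -/

/-- The absolute value of the (unnormalized) Bergman kernel of the unit disc. -/
noncomputable def discAbsKernel (z v : ℂ) : ℝ≥0∞ := (‖1 - z * conj v‖ₑ ^ 2)⁻¹

theorem discAbsKernel_comm (z v : ℂ) : discAbsKernel z v = discAbsKernel v z := by
  have h : 1 - v * conj z = conj (1 - z * conj v) := by simp [mul_comm]
  have h2 : ‖1 - v * conj z‖ₑ = ‖1 - z * conj v‖ₑ := by
    rw [h, ← ofReal_norm, RCLike.norm_conj, ofReal_norm]
  rw [discAbsKernel, discAbsKernel, h2]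

theorem measurable_discAbsKernel : Measurable (Function.uncurry discAbsKernel) := by
  have : Measurable (conj : ℂ → ℂ) := Complex.continuous_conj.measurable
  unfold discAbsKernel Function.uncurry
  fun_prop

theorem Measurable.discAbsKernel {α : Type*} [MeasurableSpace α] {f g : α → ℂ}
    (hf : Measurable f) (hg : Measurable g) :
    Measurable fun x => discAbsKernel (f x) (g x) := by
  have h := measurable_discAbsKernel.comp (hf.prodMk hg)
  simpa only [Function.comp_def, Function.uncurry] using h

theorem discAbsKernel_eq_ofReal {z v : ℂ} (hz : ‖z‖ < 1) (hv : ‖v‖ < 1) :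
    discAbsKernel z v = ENNReal.ofReal (‖1 - z * conj v‖ ^ 2)⁻¹ := by
  have h := norm_pos_iff.2 (one_sub_mul_conj_ne_zero hz hv)
  rw [discAbsKernel, ENNReal.ofReal_inv_of_pos (by positivity),
    ENNReal.ofReal_pow (norm_nonneg _), ofReal_norm]

theorem lintegral_circle_discAbsKernel {z : ℂ} (hz : ‖z‖ < 1) {r : ℝ} (hr0 : 0 < r) (hr1 : r < 1) :
    ∫⁻ θ in Ioo (-Real.pi) Real.pi, discAbsKernel z (circleMap 0 r θ) =
      ENNReal.ofReal (2 * Real.pi * (1 - ‖z‖ ^ 2 * r ^ 2)⁻¹) := by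
  have hnorm : ∀ θ, ‖circleMap 0 r θ‖ < 1 := fun θ => by simpa [abs_of_pos hr0] using hr1
  simp only [discAbsKernel_eq_ofReal hz (hnorm _)]
  have hcont : Continuous fun θ => (‖1 - z * conj (circleMap 0 r θ)‖ ^ 2)⁻¹ := by
    refine Continuous.inv₀ ?_ fun θ => pow_ne_zero 2
      (norm_ne_zero_iff.2 (one_sub_mul_conj_ne_zero hz (hnorm θ)))
    have := Complex.continuous_conj.comp (continuous_circleMap 0 r)
    exact ((continuous_const.sub (continuous_const.mul this)).norm).pow 2
  rw [← ofReal_integral_eq_lintegral_ofReal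
    ((hcont.integrableOn_Icc).mono_set Ioo_subset_Icc_self)
    (Eventually.of_forall fun θ => by positivity),
    integral_Ioo_circleMap (fun v => (‖1 - z * conj v‖ ^ 2)⁻¹),
    circleAverage_norm_bergmanKernel hz hr0 hr1, smul_eq_mul]

/-- Split at `y = δ`: the inner part converges because `a < 1`, the outer because `a > 0`. -/
theorem lintegral_rpow_mul_inv_max_le {a δ : ℝ} (ha0 : 0 < a) (ha1 : a < 1) (hδ : 0 < δ) :
    ∫⁻ y in Ioi (0 : ℝ), ENNReal.ofReal (y ^ (-a) * (max δ y)⁻¹) ≤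
      ENNReal.ofReal ((1 / (1 - a) + 1 / a) * δ ^ (-a)) := by
  have h1a : 0 < 1 - a := by linarith
  rw [← Ioc_union_Ioi_eq_Ioi hδ.le, lintegral_union measurableSet_Ioi
    (Ioc_disjoint_Ioi le_rfl), add_mul, ENNReal.ofReal_add (by positivity) (by positivity)]
  refine add_le_add ?_ ?_
  · have hint : IntegrableOn (fun y : ℝ => y ^ (-a)) (Ioc 0 δ) :=
      (intervalIntegrable_iff_integrableOn_Ioc_of_le hδ.le).1
        (intervalIntegral.intervalIntegrable_rpow' (by linarith))
    have hval : ∫ y in Ioc 0 δ, y ^ (-a) * δ⁻¹ = 1 / (1 - a) * δ ^ (-a) := by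
      rw [integral_mul_const, ← intervalIntegral.integral_of_le hδ.le,
        integral_rpow (Or.inl (by linarith)), Real.zero_rpow (by linarith), sub_zero,
        Real.rpow_add hδ, Real.rpow_one, show -a + 1 = 1 - a by ring]
      field_simp
    rw [← hval, ofReal_integral_eq_lintegral_ofReal (hint.mul_const _)]
    · refine setLIntegral_mono' measurableSet_Ioc fun y hy => ?_
      rw [max_eq_left hy.2]
    · filter_upwards [ae_restrict_mem measurableSet_Ioc] with y hy
      have := hy.1
      positivity
  · have hval : ∫ y in Ioi δ, y ^ (-a - 1) = 1 / a * δ ^ (-a) := by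
      rw [integral_Ioi_rpow_of_lt (by linarith) hδ, sub_add_cancel]
      field_simp
    rw [← hval, ofReal_integral_eq_lintegral_ofReal
      (integrableOn_Ioi_rpow_of_lt (by linarith) hδ)]
    · refine setLIntegral_mono' measurableSet_Ioi fun y hy => ?_
      have hy0 : 0 < y := hδ.trans hy
      rw [max_eq_right (le_of_lt hy), Real.rpow_sub_one hy0.ne', div_eq_mul_inv]
    · filter_upwards [ae_restrict_mem measurableSet_Ioi] with y hy
      have : 0 < y := hδ.trans hy
      positivity

/-- The test function `(1 - |v|) ^ (-a)` on the disc. -/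
noncomputable def discWeight (a : ℝ) (v : ℂ) : ℝ≥0∞ := ENNReal.ofReal ((1 - ‖v‖) ^ (-a))

theorem measurable_discWeight (a : ℝ) : Measurable (discWeight a) := by
  unfold discWeight; fun_prop

/-- The circle average of the kernel is `1 / (1 - |z|² r²)`, and this denominator is at least `1 -
|z|` and at least `1 - r`. With `y = 1 - r` only the previous one-dimensional integral remains. -/
theorem lintegral_discAbsKernel_mul_discWeight_le {a : ℝ} (ha0 : 0 < a) (ha1 : a < 1) {z : ℂ}
    (hz : ‖z‖ < 1) :
    ∫⁻ v in ball (0 : ℂ) 1, discAbsKernel z v * discWeight a v ≤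
      ENNReal.ofReal (2 * Real.pi * (1 / (1 - a) + 1 / a)) * discWeight a z := by
  have hδ : 0 < 1 - ‖z‖ := by linarith
  have hm : Measurable fun v => discAbsKernel z v * discWeight a v :=
    (measurable_discAbsKernel.comp measurable_prodMk_left).mul (measurable_discWeight a)
  have hmc : ∀ r, Measurable fun θ => discAbsKernel z (circleMap 0 r θ) := fun r =>
    (measurable_discAbsKernel.comp measurable_prodMk_left).comp
      (continuous_circleMap 0 r).measurable
  rw [setLIntegral_ball_polar hm]
  calc ∫⁻ r in Ioo (0 : ℝ) 1, ENNReal.ofReal r * ∫⁻ θ in Ioo (-Real.pi) Real.pi,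
        discAbsKernel z (circleMap 0 r θ) * discWeight a (circleMap 0 r θ)
      ≤ ∫⁻ r in Ioo (0 : ℝ) 1, ENNReal.ofReal (2 * Real.pi) *
          ENNReal.ofReal ((1 - r) ^ (-a) * (max (1 - ‖z‖) (1 - r))⁻¹) := by
        refine setLIntegral_mono' measurableSet_Ioo fun r hr => ?_
        have hr1 : 0 < 1 - r := by linarith [hr.2]
        have hw : ∀ θ, discWeight a (circleMap 0 r θ) = ENNReal.ofReal ((1 - r) ^ (-a)) :=
          fun θ => by simp [discWeight, abs_of_pos hr.1]
        simp only [hw]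
        have hpow : 0 < (1 - r) ^ (-a) := by positivity
        rw [lintegral_mul_const _ (hmc r), lintegral_circle_discAbsKernel hz hr.1 hr.2,
          ← ENNReal.ofReal_mul' hpow.le, ← ENNReal.ofReal_mul hr.1.le,
          ← ENNReal.ofReal_mul Real.two_pi_pos.le]
        refine ENNReal.ofReal_le_ofReal ?_
        have hzr : ‖z‖ * r < 1 := by nlinarith [norm_nonneg z, hr.1, hr.2]
        have hmax : max (1 - ‖z‖) (1 - r) ≤ 1 - ‖z‖ ^ 2 * r ^ 2 := by
          have h2 : ‖z‖ ^ 2 * r ^ 2 ≤ ‖z‖ * r := by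
            rw [← mul_pow]
            exact pow_le_of_le_one (mul_nonneg (norm_nonneg z) hr.1.le) hzr.le two_ne_zero
          refine max_le ?_ ?_ <;> nlinarith [norm_nonneg z, hr.1, hr.2]
        have hinv : (1 - ‖z‖ ^ 2 * r ^ 2)⁻¹ ≤ (max (1 - ‖z‖) (1 - r))⁻¹ :=
          inv_anti₀ (lt_max_of_lt_left hδ) hmax
        have hmpos : 0 < (max (1 - ‖z‖) (1 - r))⁻¹ := inv_pos.2 (lt_max_of_lt_left hδ)
        have hpi := Real.pi_pos
        calc r * (2 * Real.pi * (1 - ‖z‖ ^ 2 * r ^ 2)⁻¹ * (1 - r) ^ (-a))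
            ≤ 1 * (2 * Real.pi * (max (1 - ‖z‖) (1 - r))⁻¹ * (1 - r) ^ (-a)) := by
              have : 0 ≤ (1 - ‖z‖ ^ 2 * r ^ 2)⁻¹ := inv_nonneg.2 (hδ.le.trans
                ((le_max_left _ _).trans hmax))
              have := hr.2.le
              gcongr
          _ = _ := by ring
    _ = ENNReal.ofReal (2 * Real.pi) * ∫⁻ y in Ioo (0 : ℝ) 1,
          ENNReal.ofReal (y ^ (-a) * (max (1 - ‖z‖) y)⁻¹) := by
        rw [lintegral_const_mul _ (by fun_prop), ← lintegral_indicator measurableSet_Ioo,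
          ← lintegral_indicator measurableSet_Ioo]
        congr 1
        rw [← lintegral_sub_left_eq_self _ (1 : ℝ)]
        refine lintegral_congr fun r => ?_
        simp only [indicator, mem_Ioo, sub_sub_cancel, sub_pos, sub_lt_self_iff, and_comm]
    _ ≤ ENNReal.ofReal (2 * Real.pi) *
          ENNReal.ofReal ((1 / (1 - a) + 1 / a) * (1 - ‖z‖) ^ (-a)) := by
        refine mul_le_mul_right ((lintegral_mono_set Ioo_subset_Ioi_self).trans
          (lintegral_rpow_mul_inv_max_le ha0 ha1 hδ)) _
    _ = _ := by
        have : 0 < 1 - a := by linarith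
        have hpi := Real.pi_pos
        rw [discWeight, ← ENNReal.ofReal_mul (by positivity), ← ENNReal.ofReal_mul (by positivity)]
        congr 1
        ring

theorem discWeight_rpow {a q : ℝ} {v : ℂ} (hv : ‖v‖ < 1) (hq : 0 ≤ q) :
    discWeight a v ^ q = discWeight (a * q) v := by
  have h : 0 < 1 - ‖v‖ := by linarith
  rw [discWeight, discWeight, ENNReal.ofReal_rpow_of_nonneg (by positivity) hq,
    ← Real.rpow_mul h.le, neg_mul]

theorem exists_lintegral_discAbsKernel_rpow_le :
    ∃ C : ℝ≥0, ∀ f : ℂ → ℝ≥0∞, Measurable f →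
      ∫⁻ z in ball (0 : ℂ) 1, (∫⁻ v in ball (0 : ℂ) 1, discAbsKernel z v * f v) ^ (4 / 3 : ℝ) ≤
        C * ∫⁻ v in ball (0 : ℂ) 1, f v ^ (4 / 3 : ℝ) := by
  have hpq : (4 / 3 : ℝ).HolderConjugate 4 := by
    rw [Real.holderConjugate_iff]; norm_num
  set c : ℝ → ℝ≥0∞ := fun a => ENNReal.ofReal (2 * Real.pi * (1 / (1 - a) + 1 / a)) with hc
  have hmem : ∀ᵐ v ∂(volume.restrict (ball (0 : ℂ) 1)), ‖v‖ < 1 := by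
    filter_upwards [ae_restrict_mem measurableSet_ball] with v hv using by simpa using hv
  -- Schur's test is run with the weight exponent `1/8` and the powers `q = 4` and `q = 4/3`; all
  -- that matters is `0 < q / 8 < 1`.
  have htest : ∀ q : ℝ, 0 < q → q < 8 → ∀ z : ℂ, ‖z‖ < 1 →
      ∫⁻ v in ball (0 : ℂ) 1, discAbsKernel z v * discWeight (1 / 8) v ^ q ≤
        c (1 / 8 * q) * discWeight (1 / 8) z ^ q := by
    intro q hq0 hq8 z hz
    rw [discWeight_rpow hz hq0.le]
    refine le_trans (le_of_eq ?_)
      (lintegral_discAbsKernel_mul_discWeight_le (by positivity) (by linarith) hz)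
    refine setLIntegral_congr_fun measurableSet_ball fun v hv => ?_
    simp only [discWeight_rpow (show ‖v‖ < 1 by simpa using hv) hq0.le]
  refine ⟨(c (1 / 8 * 4) ^ (4 / 3 / 4 : ℝ) * c (1 / 8 * (4 / 3))).toNNReal, fun f hf => ?_⟩
  rw [ENNReal.coe_toNNReal (ENNReal.mul_ne_top (ENNReal.rpow_ne_top_of_nonneg (by norm_num)
    ENNReal.ofReal_ne_top) ENNReal.ofReal_ne_top)]
  refine lintegral_rpow_le_of_schur hpq measurable_discAbsKernel (measurable_discWeight (1 / 8))
    ?_ ?_ ?_ ?_ hf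
  · filter_upwards [hmem] with v hv
    have : 0 < 1 - ‖v‖ := by linarith
    rw [discWeight, Ne, ENNReal.ofReal_eq_zero, not_le]
    positivity
  · exact Eventually.of_forall fun v => ENNReal.ofReal_ne_top
  · filter_upwards [hmem] with z hz using htest 4 (by norm_num) (by norm_num) z hz
  · filter_upwards [hmem] with z hz
    simp only [discAbsKernel_comm _ z]
    exact htest (4 / 3) (by norm_num) (by norm_num) z hz

/-! ### Logarithmic weights on the disc -/

theorem one_le_one_sub_log {r : ℝ} (hr0 : 0 ≤ r) (hr1 : r ≤ 1) : 1 ≤ -Real.log r + 1 := by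
  linarith [Real.log_nonpos hr0 hr1]

theorem integrableOn_inv_mul_log_rpow {b : ℝ} (hb : 1 < b) :
    IntegrableOn (fun r : ℝ => r⁻¹ * (-Real.log r + 1) ^ (-b)) (Ioc 0 1) := by
  set g₀ : ℝ → ℝ := fun r => (b - 1)⁻¹ * (-Real.log r + 1) ^ (-(b - 1)) with hg₀
  have hlog : ∀ r ∈ Ioc (0 : ℝ) 1, 0 < -Real.log r + 1 := fun r hr =>
    one_pos.trans_le (one_le_one_sub_log hr.1.le hr.2)
  have hder : ∀ r ∈ Ioc (0 : ℝ) 1, HasDerivAt g₀ (r⁻¹ * (-Real.log r + 1) ^ (-b)) r := by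
    intro r hr
    have h1 : HasDerivAt (fun r => -Real.log r + 1) (-r⁻¹) r :=
      ((Real.hasDerivAt_log hr.1.ne').neg).add_const 1
    have h2 := (h1.rpow_const (p := -(b - 1)) (Or.inl (hlog r hr).ne')).const_mul (b - 1)⁻¹
    refine h2.congr_deriv ?_
    rw [show -(b - 1) - 1 = -b by ring]
    have : b - 1 ≠ 0 := by linarith
    field_simp
  -- Since `Real.log 0 = 0`, the primitive `g₀` has the wrong value at `0`; the update puts its
  -- limit `0` there. The limit exists because `b > 1`.
  refine intervalIntegral.integrableOn_deriv_of_nonneg (g := Function.update g₀ 0 0) ?_ ?_ ?_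
  · rw [continuousOn_update_iff, Icc_sdiff_left]
    refine ⟨fun r hr => (hder r hr).continuousAt.continuousWithinAt, fun _ => ?_⟩
    have h1 : Tendsto (fun r => -Real.log r + 1) (𝓝[Ioc 0 1] 0) atTop :=
      tendsto_atTop_add_const_right _ _ (tendsto_neg_atBot_atTop.comp
        (Real.tendsto_log_nhdsGT_zero.mono_left (nhdsWithin_mono _ Ioc_subset_Ioi_self)))
    have h2 := ((tendsto_rpow_neg_atTop (sub_pos.2 hb)).comp h1).const_mul (b - 1)⁻¹
    rw [mul_zero] at h2
    exact h2
  · intro r hr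
    refine (hder r ⟨hr.1, hr.2.le⟩).congr_of_eventuallyEq ?_
    filter_upwards [isOpen_ne.mem_nhds hr.1.ne'] with x hx
    rw [Function.update_of_ne hx]
  · intro r hr
    have := hlog r ⟨hr.1, hr.2.le⟩
    have := hr.1
    positivity

theorem setLIntegral_inv_sq_mul_log_rpow_ne_top {b : ℝ} (hb : 1 < b) :
    ∫⁻ v in ball (0 : ℂ) 1, ENNReal.ofReal ((‖v‖ ^ 2)⁻¹ * (-Real.log ‖v‖ + 1) ^ (-b)) ≠ ∞ := by
  rw [setLIntegral_ball_radial (φ := fun r => ENNReal.ofReal ((r ^ 2)⁻¹ * (-Real.log r + 1) ^ (-b)))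
    (by fun_prop)]
  refine ENNReal.mul_ne_top ENNReal.ofReal_ne_top ?_
  have h := ((integrableOn_inv_mul_log_rpow hb).mono_set Ioo_subset_Ioc_self).lintegral_lt_top.ne
  convert h using 1
  refine setLIntegral_congr_fun measurableSet_Ioo fun r hr => ?_
  rw [← ENNReal.ofReal_mul hr.1.le]
  congr 1
  have := hr.1.ne'
  field_simp

/-- The weight on the unit disc which corresponds to the weight `(-log |z₂| + 1) ^ ε` on the
Hartogs triangle for the exponent `4 / 3`. -/
noncomputable def logDiscWeight (ε : ℝ) (v : ℂ) : ℝ≥0∞ :=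
  ‖v‖ₑ ^ (2 / 3 : ℝ) * ENNReal.ofReal ((-Real.log ‖v‖ + 1) ^ ε)

theorem measurable_logDiscWeight (ε : ℝ) : Measurable (logDiscWeight ε) := by
  unfold logDiscWeight; fun_prop

theorem logDiscWeight_eq_ofReal (ε : ℝ) (v : ℂ) :
    logDiscWeight ε v = ENNReal.ofReal (‖v‖ ^ (2 / 3 : ℝ) * (-Real.log ‖v‖ + 1) ^ ε) := by
  rw [logDiscWeight, ENNReal.ofReal_mul (by positivity),
    ← ENNReal.ofReal_rpow_of_nonneg (norm_nonneg v) (by norm_num), ofReal_norm]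

theorem logDiscWeight_real_pos (ε : ℝ) {v : ℂ} (hv0 : v ≠ 0) (hv1 : ‖v‖ < 1) :
    0 < ‖v‖ ^ (2 / 3 : ℝ) * (-Real.log ‖v‖ + 1) ^ ε := by
  have h1 := norm_pos_iff.2 hv0
  have h2 := one_pos.trans_le (one_le_one_sub_log h1.le hv1.le)
  positivity

theorem ae_ball_ne_zero_and_norm_lt :
    ∀ᵐ v ∂(volume.restrict (ball (0 : ℂ) 1)), v ≠ 0 ∧ ‖v‖ < 1 := by
  have h : ∀ᵐ v : ℂ ∂(volume.restrict (ball 0 1)), v ≠ 0 :=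
    ae_restrict_of_ae (by simp [ae_iff, measure_singleton])
  filter_upwards [h, ae_restrict_mem measurableSet_ball] with v hv hv1
  exact ⟨hv, by simpa using hv1⟩

/-- The threshold enters here: the integrand is `|v|^(-2) (1 - log |v|)^(-3ε)`, and `3ε > 1`. -/
theorem setLIntegral_logDiscWeight_rpow_ne_top {ε : ℝ} (hε : 1 / 3 < ε) :
    ∫⁻ v in ball (0 : ℂ) 1, logDiscWeight ε v ^ (-3 : ℝ) ≠ ∞ := by
  convert setLIntegral_inv_sq_mul_log_rpow_ne_top (show 1 < 3 * ε by linarith) using 1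
  refine lintegral_congr_ae ?_
  filter_upwards [ae_ball_ne_zero_and_norm_lt] with v hv
  have h1 := norm_pos_iff.2 hv.1
  have h2 := one_pos.trans_le (one_le_one_sub_log h1.le hv.2.le)
  rw [logDiscWeight_eq_ofReal, ENNReal.ofReal_rpow_of_pos (logDiscWeight_real_pos ε hv.1 hv.2),
    Real.mul_rpow (by positivity) (by positivity), ← Real.rpow_mul h1.le, ← Real.rpow_mul h2.le]
  congr 2
  · rw [show (2 / 3 : ℝ) * -3 = -(2 : ℕ) by norm_num, Real.rpow_neg h1.le, Real.rpow_natCast]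
  · ring_nf

/-- Hölder with exponents `4/3` and `4` applied to `φ = (φ W^(3/4)) W^(-3/4)`. -/
theorem exists_setLIntegral_le_logDiscWeight {ε : ℝ} (hε : 1 / 3 < ε) :
    ∃ C : ℝ≥0∞, C ≠ ∞ ∧ ∀ φ : ℂ → ℝ≥0∞, Measurable φ →
      ∫⁻ v in ball (0 : ℂ) 1, φ v ≤
        C * (∫⁻ v in ball (0 : ℂ) 1, φ v ^ (4 / 3 : ℝ) * logDiscWeight ε v) ^ (3 / 4 : ℝ) := by
  refine ⟨(∫⁻ v in ball (0 : ℂ) 1, logDiscWeight ε v ^ (-3 : ℝ)) ^ (1 / 4 : ℝ),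
    ENNReal.rpow_ne_top_of_nonneg (by norm_num) (setLIntegral_logDiscWeight_rpow_ne_top hε),
    fun φ hφ => ?_⟩
  have hpq : (4 / 3 : ℝ).HolderConjugate 4 := by
    rw [Real.holderConjugate_iff]; norm_num
  have hW := measurable_logDiscWeight ε
  have e1 : ∫⁻ v in ball (0 : ℂ) 1, φ v = ∫⁻ v in ball (0 : ℂ) 1,
      ((fun v => φ v * logDiscWeight ε v ^ (3 / 4 : ℝ)) *
        fun v => logDiscWeight ε v ^ (-(3 / 4) : ℝ)) v := by
    refine lintegral_congr_ae ?_
    filter_upwards [ae_ball_ne_zero_and_norm_lt] with v hv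
    have h0 : logDiscWeight ε v ≠ 0 := by
      rw [logDiscWeight_eq_ofReal, Ne, ENNReal.ofReal_eq_zero, not_le]
      exact logDiscWeight_real_pos ε hv.1 hv.2
    have ht : logDiscWeight ε v ≠ ∞ := by
      rw [logDiscWeight_eq_ofReal]; exact ENNReal.ofReal_ne_top
    simp only [Pi.mul_apply]
    rw [mul_assoc, ← ENNReal.rpow_add _ _ h0 ht, add_neg_cancel, ENNReal.rpow_zero, mul_one]
  have e2 := ENNReal.lintegral_mul_le_Lp_mul_Lq (volume.restrict (ball (0 : ℂ) 1)) hpq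
    (f := fun v => φ v * logDiscWeight ε v ^ (3 / 4 : ℝ))
    (g := fun v => logDiscWeight ε v ^ (-(3 / 4) : ℝ))
    (hφ.mul (hW.pow_const _)).aemeasurable (hW.pow_const _).aemeasurable
  rw [← e1] at e2
  refine e2.trans (le_of_eq ?_)
  rw [mul_comm]
  congr 1
  · congr 1
    refine lintegral_congr fun v => ?_
    rw [← ENNReal.rpow_mul]; norm_num
  · rw [show (1 / (4 / 3) : ℝ) = 3 / 4 by norm_num]
    congr 1
    refine lintegral_congr fun v => ?_
    rw [ENNReal.mul_rpow_of_nonneg _ _ (by norm_num), ← ENNReal.rpow_mul]; norm_num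

theorem discAbsKernel_le_four {z v : ℂ} (hz : ‖z‖ < 1) (hv : ‖v‖ < 1 / 2) :
    discAbsKernel z v ≤ 4 := by
  have h : (1 / 2 : ℝ) ≤ ‖1 - z * conj v‖ := by
    have h := norm_sub_norm_le (1 : ℂ) (z * conj v)
    rw [norm_one, norm_mul, RCLike.norm_conj] at h
    nlinarith [norm_nonneg z, norm_nonneg v]
  rw [discAbsKernel_eq_ofReal hz (by linarith),
    show (4 : ℝ≥0∞) = ENNReal.ofReal 4 by norm_num]
  refine ENNReal.ofReal_le_ofReal ?_
  calc (‖1 - z * conj v‖ ^ 2)⁻¹ ≤ ((1 / 2 : ℝ) ^ 2)⁻¹ := by gcongr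
    _ = 4 := by norm_num

theorem one_le_four_mul_logDiscWeight {ε : ℝ} (hε : 0 ≤ ε) {v : ℂ} (hv1 : 1 / 2 ≤ ‖v‖)
    (hv2 : ‖v‖ < 1) : 1 ≤ 4 * logDiscWeight ε v := by
  rw [logDiscWeight_eq_ofReal, show (4 : ℝ≥0∞) = ENNReal.ofReal 4 by norm_num,
    ← ENNReal.ofReal_mul (by norm_num), ENNReal.one_le_ofReal]
  have h1 : 1 ≤ (-Real.log ‖v‖ + 1) ^ ε :=
    Real.one_le_rpow (one_le_one_sub_log (norm_nonneg v) hv2.le) hε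
  have h2 : ‖v‖ ≤ ‖v‖ ^ (2 / 3 : ℝ) := by
    conv_lhs => rw [← Real.rpow_one ‖v‖]
    exact Real.rpow_le_rpow_of_exponent_ge (by linarith) hv2.le (by norm_num)
  nlinarith

/-- Cut the source at `|v| = 1/2`. Inside, the kernel is at most `4` and the weighted Hölder bound
applies; outside, `W ≥ 1/4` reduces the claim to the unweighted estimate. -/
theorem exists_lintegral_discAbsKernel_rpow_le_logDiscWeight {ε : ℝ} (hε : 1 / 3 < ε) :
    ∃ C : ℝ≥0∞, C ≠ ∞ ∧ ∀ φ : ℂ → ℝ≥0∞, Measurable φ →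
      ∫⁻ z in ball (0 : ℂ) 1, (∫⁻ v in ball (0 : ℂ) 1, discAbsKernel z v * φ v) ^ (4 / 3 : ℝ) ≤
        C * ∫⁻ v in ball (0 : ℂ) 1, φ v ^ (4 / 3 : ℝ) * logDiscWeight ε v := by
  obtain ⟨C₁, hC₁, h₁⟩ := exists_setLIntegral_le_logDiscWeight hε
  obtain ⟨C₂, h₂⟩ := exists_lintegral_discAbsKernel_rpow_le
  -- The power of `2` comes from convexity: `(a + b)^p ≤ 2^(p-1) (a^p + b^p)` with `p = 4/3`.
  refine ⟨2 ^ (4 / 3 - 1 : ℝ) *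
    ((4 * C₁) ^ (4 / 3 : ℝ) * volume (ball (0 : ℂ) 1) + C₂ * 4), ?_, fun φ hφ => ?_⟩
  · refine ENNReal.mul_ne_top (ENNReal.rpow_ne_top_of_nonneg (by norm_num) (by simp))
      (ENNReal.add_ne_top.2 ⟨ENNReal.mul_ne_top (ENNReal.rpow_ne_top_of_nonneg (by norm_num)
        (ENNReal.mul_ne_top (by simp) hC₁)) measure_ball_lt_top.ne,
        ENNReal.mul_ne_top (by simp) (by simp)⟩)
  set N := ∫⁻ v in ball (0 : ℂ) 1, φ v ^ (4 / 3 : ℝ) * logDiscWeight ε v with hN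
  set ψ : ℂ → ℝ≥0∞ := {v : ℂ | 1 / 2 ≤ ‖v‖}.indicator φ with hψ
  have hψm : Measurable ψ := hφ.indicator (measurableSet_le measurable_const measurable_norm)
  have hsplit : ∀ z ∈ ball (0 : ℂ) 1, (∫⁻ v in ball (0 : ℂ) 1, discAbsKernel z v * φ v) ≤
      4 * C₁ * N ^ (3 / 4 : ℝ) + ∫⁻ v in ball (0 : ℂ) 1, discAbsKernel z v * ψ v := by
    intro z hz
    have hz' : ‖z‖ < 1 := by simpa using hz
    calc ∫⁻ v in ball (0 : ℂ) 1, discAbsKernel z v * φ v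
        ≤ ∫⁻ v in ball (0 : ℂ) 1, (4 * φ v + discAbsKernel z v * ψ v) := by
          refine lintegral_mono fun v => ?_
          by_cases hv : 1 / 2 ≤ ‖v‖
          · rw [hψ, indicator_of_mem (by exact hv)]
            exact le_add_self
          · exact (mul_le_mul_left (discAbsKernel_le_four hz' (not_le.1 hv)) _).trans le_self_add
      _ = 4 * (∫⁻ v in ball (0 : ℂ) 1, φ v) +
            ∫⁻ v in ball (0 : ℂ) 1, discAbsKernel z v * ψ v := by
          rw [lintegral_add_left (hφ.const_mul 4), lintegral_const_mul _ hφ]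
      _ ≤ _ := by
          rw [mul_assoc]
          gcongr
          exact h₁ φ hφ
  have hψle : ∫⁻ v in ball (0 : ℂ) 1, ψ v ^ (4 / 3 : ℝ) ≤ 4 * N := by
    have hm : Measurable fun v => φ v ^ (4 / 3 : ℝ) * logDiscWeight ε v :=
      (hφ.pow_const _).mul (measurable_logDiscWeight ε)
    rw [hN, ← lintegral_const_mul _ hm]
    refine setLIntegral_mono' measurableSet_ball fun v hv => ?_
    have hv' : ‖v‖ < 1 := by simpa using hv
    by_cases hv2 : 1 / 2 ≤ ‖v‖
    · rw [hψ, indicator_of_mem (by exact hv2)]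
      calc φ v ^ (4 / 3 : ℝ) = φ v ^ (4 / 3 : ℝ) * 1 := (mul_one _).symm
        _ ≤ φ v ^ (4 / 3 : ℝ) * (4 * logDiscWeight ε v) := by
          gcongr
          exact one_le_four_mul_logDiscWeight (by linarith) hv2 hv'
        _ = _ := by ring
    · rw [hψ, indicator_of_notMem (by exact hv2), ENNReal.zero_rpow_of_pos (by norm_num)]
      exact zero_le
  calc ∫⁻ z in ball (0 : ℂ) 1, (∫⁻ v in ball (0 : ℂ) 1, discAbsKernel z v * φ v) ^ (4 / 3 : ℝ)
      ≤ ∫⁻ z in ball (0 : ℂ) 1, 2 ^ (4 / 3 - 1 : ℝ) * ((4 * C₁ * N ^ (3 / 4 : ℝ)) ^ (4 / 3 : ℝ) +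
          (∫⁻ v in ball (0 : ℂ) 1, discAbsKernel z v * ψ v) ^ (4 / 3 : ℝ)) := by
        refine setLIntegral_mono' measurableSet_ball fun z hz => ?_
        exact (ENNReal.rpow_le_rpow (hsplit z hz) (by norm_num)).trans
          (ENNReal.rpow_add_le_mul_rpow_add_rpow _ _ (by norm_num))
    _ = 2 ^ (4 / 3 - 1 : ℝ) * ((4 * C₁ * N ^ (3 / 4 : ℝ)) ^ (4 / 3 : ℝ) * volume (ball (0 : ℂ) 1) +
          ∫⁻ z in ball (0 : ℂ) 1,
            (∫⁻ v in ball (0 : ℂ) 1, discAbsKernel z v * ψ v) ^ (4 / 3 : ℝ)) := by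
        rw [lintegral_const_mul' _ _ (ENNReal.rpow_ne_top_of_nonneg (by norm_num) (by simp)),
          lintegral_add_left measurable_const, setLIntegral_const]
    _ ≤ 2 ^ (4 / 3 - 1 : ℝ) * ((4 * C₁) ^ (4 / 3 : ℝ) * N * volume (ball (0 : ℂ) 1) +
          C₂ * (4 * N)) := by
        rw [ENNReal.mul_rpow_of_nonneg (4 * C₁) _ (by norm_num : (0 : ℝ) ≤ 4 / 3),
          ← ENNReal.rpow_mul N, show (3 / 4 * (4 / 3) : ℝ) = 1 by norm_num, ENNReal.rpow_one]
        gcongr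
        exact (h₂ ψ hψm).trans (mul_le_mul_right hψle _)
    _ = _ := by ring

/-- The operator is iterated: `B` integrates in the second variable. The unweighted bound is used in
`u` for fixed second coordinate, then the weighted one in `v`, with Tonelli in between. -/
theorem exists_lintegral_bidisc_rpow_le {ε : ℝ} (hε : 1 / 3 < ε) :
    ∃ C : ℝ≥0∞, C ≠ ∞ ∧ ∀ F : ℂ × ℂ → ℝ≥0∞, Measurable F →
      ∫⁻ p in bidisc, (∫⁻ q in bidisc, discAbsKernel p.1 q.1 *
        (discAbsKernel p.2 q.2 * F q)) ^ (4 / 3 : ℝ) ≤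
        C * ∫⁻ q in bidisc, F q ^ (4 / 3 : ℝ) * logDiscWeight ε q.2 := by
  obtain ⟨C₁, h₁⟩ := exists_lintegral_discAbsKernel_rpow_le
  obtain ⟨C₂, hC₂, h₂⟩ := exists_lintegral_discAbsKernel_rpow_le_logDiscWeight hε
  refine ⟨C₁ * C₂, ENNReal.mul_ne_top (by simp) hC₂, fun F hF => ?_⟩
  set ν : Measure ℂ := volume.restrict (ball (0 : ℂ) 1) with hν
  set B : ℂ × ℂ → ℝ≥0∞ := fun x => ∫⁻ v, discAbsKernel x.2 v * F (x.1, v) ∂ν with hB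
  have hBm : Measurable B := Measurable.lintegral_prod_right'
    (f := fun y : (ℂ × ℂ) × ℂ => discAbsKernel y.1.2 y.2 * F (y.1.1, y.2))
    (((measurable_snd.comp measurable_fst).discAbsKernel measurable_snd).mul
      (hF.comp (by fun_prop)))
  have hinner : ∀ p : ℂ × ℂ, ∫⁻ q, discAbsKernel p.1 q.1 * (discAbsKernel p.2 q.2 * F q)
      ∂(ν.prod ν) = ∫⁻ u, discAbsKernel p.1 u * B (u, p.2) ∂ν := by
    intro p
    have hm₂ : Measurable fun q : ℂ × ℂ => discAbsKernel p.1 q.1 * (discAbsKernel p.2 q.2 * F q) :=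
      (measurable_const.discAbsKernel measurable_fst).mul
        ((measurable_const.discAbsKernel measurable_snd).mul hF)
    rw [lintegral_prod _ hm₂.aemeasurable]
    refine lintegral_congr fun u => ?_
    have hm : Measurable fun v => discAbsKernel p.2 v * F (u, v) :=
      (measurable_const.discAbsKernel measurable_id).mul (hF.comp measurable_prodMk_left)
    simp only [hB]
    rw [lintegral_const_mul _ hm]
  have hTm : Measurable fun p : ℂ × ℂ =>
      (∫⁻ u, discAbsKernel p.1 u * B (u, p.2) ∂ν) ^ (4 / 3 : ℝ) :=
    (Measurable.lintegral_prod_right'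
      (f := fun y : (ℂ × ℂ) × ℂ => discAbsKernel y.1.1 y.2 * B (y.2, y.1.2))
      (((measurable_fst.comp measurable_fst).discAbsKernel measurable_snd).mul
        (hBm.comp (by fun_prop)))).pow_const _
  rw [restrict_bidisc, ← hν]
  simp only [hinner]
  have hBp : Measurable fun x : ℂ × ℂ => B x ^ (4 / 3 : ℝ) := hBm.pow_const _
  calc ∫⁻ p, (∫⁻ u, discAbsKernel p.1 u * B (u, p.2) ∂ν) ^ (4 / 3 : ℝ) ∂(ν.prod ν)
      = ∫⁻ t, ∫⁻ s, (∫⁻ u, discAbsKernel s u * B (u, t) ∂ν) ^ (4 / 3 : ℝ) ∂ν ∂ν :=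
        lintegral_prod_symm _ hTm.aemeasurable
    _ ≤ ∫⁻ t, C₁ * ∫⁻ u, B (u, t) ^ (4 / 3 : ℝ) ∂ν ∂ν :=
        lintegral_mono fun t => h₁ (fun u => B (u, t)) (hBm.comp measurable_prodMk_right)
    _ = C₁ * ∫⁻ u, ∫⁻ t, B (u, t) ^ (4 / 3 : ℝ) ∂ν ∂ν := by
        rw [lintegral_const_mul' _ _ (by simp), lintegral_lintegral_swap]
        exact (hBp.comp measurable_swap).aemeasurable
    _ ≤ C₁ * ∫⁻ u, C₂ * ∫⁻ v, F (u, v) ^ (4 / 3 : ℝ) * logDiscWeight ε v ∂ν ∂ν := by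
        gcongr with u
        exact h₂ (fun v => F (u, v)) (hF.comp measurable_prodMk_left)
    _ = C₁ * C₂ * ∫⁻ q, F q ^ (4 / 3 : ℝ) * logDiscWeight ε q.2 ∂(ν.prod ν) := by
        have hm : Measurable fun q : ℂ × ℂ => F q ^ (4 / 3 : ℝ) * logDiscWeight ε q.2 :=
          (hF.pow_const _).mul ((measurable_logDiscWeight ε).comp measurable_snd)
        rw [lintegral_const_mul' _ _ hC₂, lintegral_prod _ hm.aemeasurable, mul_assoc]

/-! ### The weak-type estimate -/

theorem log_weight_pos {z : ℂ × ℂ} (hz : z ∈ hartogsTriangle) (ε : ℝ) :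
    0 < (-Real.log ‖z.2‖ + 1) ^ ε :=
  Real.rpow_pos_of_pos (one_pos.trans_le (one_le_one_sub_log (norm_nonneg _) hz.2.le)) _

theorem restrict_hartogsTriangle_absolutelyContinuous (ε : ℝ) :
    volume.restrict hartogsTriangle ≪ logWeightedMeasure ε := by
  refine withDensity_absolutelyContinuous' (by fun_prop) ?_
  filter_upwards [ae_mem_hartogsTriangle] with z hz
  rw [Ne, ENNReal.ofReal_eq_zero, not_le]
  exact log_weight_pos hz ε

theorem eLpNorm_four_thirds_rpow {α : Type*} [MeasurableSpace α] (μ : Measure α) (f : α → ℂ) :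
    eLpNorm f (4 / 3) μ ^ (4 / 3 : ℝ) = ∫⁻ x, ‖f x‖ₑ ^ (4 / 3 : ℝ) ∂μ := by
  have h : (4 / 3 : ℝ≥0∞).toReal = 4 / 3 := by simp
  rw [eLpNorm_eq_lintegral_rpow_enorm_toReal (by simp) (ENNReal.div_ne_top (by simp) (by simp)), h,
    ← ENNReal.rpow_mul]
  norm_num

/-- The Jacobian `|v|²` splits as `|v|^(4/3) |v|^(2/3)`: the first factor goes into the pullback,
the second into the weight. -/
theorem eLpNorm_logWeightedMeasure_rpow (ε : ℝ) {f : ℂ × ℂ → ℂ}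
    (hf : AEStronglyMeasurable f (volume.restrict hartogsTriangle)) :
    eLpNorm f (4 / 3) (logWeightedMeasure ε) ^ (4 / 3 : ℝ) =
      ∫⁻ q in bidisc, ‖bidiscPullback f q‖ₑ ^ (4 / 3 : ℝ) * logDiscWeight ε q.2 := by
  have hw : Measurable fun z : ℂ × ℂ => ENNReal.ofReal ((-Real.log ‖z.2‖ + 1) ^ ε) := by fun_prop
  have hfe : AEMeasurable (fun z => ‖f z‖ₑ ^ (4 / 3 : ℝ)) (volume.restrict hartogsTriangle) :=
    hf.enorm.pow_const _
  rw [eLpNorm_four_thirds_rpow, logWeightedMeasure,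
    lintegral_withDensity_eq_lintegral_mul₀ hw.aemeasurable hfe,
    setLIntegral_hartogsTriangle' (hw.aemeasurable.mul hfe)]
  refine lintegral_congr fun p => ?_
  have h : ‖p.2‖ₑ ^ (4 / 3 : ℝ) * ‖p.2‖ₑ ^ (2 / 3 : ℝ) = ‖p.2‖ₑ ^ 2 := by
    rw [← ENNReal.rpow_add_of_nonneg _ _ (by norm_num) (by norm_num), ← ENNReal.rpow_natCast]
    norm_num
  rw [bidiscPullback, logDiscWeight, enorm_mul, ENNReal.mul_rpow_of_nonneg _ _ (by norm_num), ← h]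
  simp only [Pi.mul_apply, hartogsMap]
  ring

theorem integrable_inv_norm_snd_mul_of_logWeightedMeasure {ε : ℝ} (hε : 1 / 3 < ε)
    {f : ℂ × ℂ → ℂ} (hf : MemLp f (4 / 3) (logWeightedMeasure ε)) :
    Integrable (fun w => ‖w.2‖⁻¹ * ‖f w‖) (volume.restrict hartogsTriangle) := by
  have hfm := hf.1.mono_ac (restrict_hartogsTriangle_absolutelyContinuous ε)
  have hm : AEStronglyMeasurable (fun w : ℂ × ℂ => ‖w.2‖⁻¹ * ‖f w‖)
      (volume.restrict hartogsTriangle) :=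
    memLp_inv_norm_snd.1.mul hfm.norm
  refine ⟨hm, ?_⟩
  obtain ⟨C, hC, h⟩ := exists_setLIntegral_le_logDiscWeight hε
  have hFm := aestronglyMeasurable_bidiscPullback hfm
  have hN := eLpNorm_logWeightedMeasure_rpow ε hfm
  obtain ⟨G, hGs, hFG⟩ := hFm
  have hNfin : ∫⁻ q in bidisc, ‖G q‖ₑ ^ (4 / 3 : ℝ) * logDiscWeight ε q.2 ≠ ∞ := by
    have h1 : eLpNorm f (4 / 3) (logWeightedMeasure ε) ^ (4 / 3 : ℝ) ≠ ∞ :=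
      ENNReal.rpow_ne_top_of_nonneg (by norm_num) hf.2.ne
    rw [hN] at h1
    convert h1 using 1
    refine lintegral_congr_ae ?_
    filter_upwards [hFG] with q hq
    rw [hq]
  have hGm : Measurable fun q => ‖G q‖ₑ := hGs.enorm
  have hGWm : Measurable fun q : ℂ × ℂ => ‖G q‖ₑ ^ (4 / 3 : ℝ) * logDiscWeight ε q.2 :=
    (hGm.pow_const _).mul ((measurable_logDiscWeight ε).comp measurable_snd)
  -- Only finiteness is wanted, so this crude bound makes the slicewise Hölder estimate integrable
  -- in `u`.
  have hpow : ∀ x : ℝ≥0∞, x ^ (3 / 4 : ℝ) ≤ 1 + x := fun x => by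
    rcases le_total x 1 with hx | hx
    · exact (ENNReal.rpow_le_one hx (by norm_num)).trans le_self_add
    · refine le_trans ?_ le_add_self
      conv_rhs => rw [← ENNReal.rpow_one x]
      exact ENNReal.rpow_le_rpow_of_exponent_le hx (by norm_num)
  rw [hasFiniteIntegral_iff_enorm, setLIntegral_hartogsTriangle' hm.enorm]
  calc ∫⁻ p in bidisc, ‖p.2‖ₑ ^ 2 * ‖‖(hartogsMap p).2‖⁻¹ * ‖f (hartogsMap p)‖‖ₑ
      = ∫⁻ p in bidisc, ‖G p‖ₑ := by
        refine lintegral_congr_ae ?_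
        filter_upwards [hFG, ae_bidisc_snd_ne_zero] with p hp hp2
        have h0 : ‖p.2‖ₑ ≠ 0 := by simpa using hp2
        rw [← hp, bidiscPullback, enorm_mul, enorm_mul, enorm_norm]
        change ‖p.2‖ₑ ^ 2 * (‖‖p.2‖⁻¹‖ₑ * _) = _
        rw [enorm_inv (by simpa using hp2), enorm_norm, sq, ← mul_assoc, mul_assoc ‖p.2‖ₑ,
          ENNReal.mul_inv_cancel h0 enorm_ne_top, mul_one]
    _ = ∫⁻ u in ball (0 : ℂ) 1, ∫⁻ v in ball (0 : ℂ) 1, ‖G (u, v)‖ₑ := by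
        rw [restrict_bidisc, lintegral_prod _ hGm.aemeasurable]
    _ ≤ ∫⁻ u in ball (0 : ℂ) 1, C * (1 + ∫⁻ v in ball (0 : ℂ) 1,
          ‖G (u, v)‖ₑ ^ (4 / 3 : ℝ) * logDiscWeight ε v) := by
        gcongr with u
        exact (h _ (hGm.comp measurable_prodMk_left)).trans (mul_le_mul_right (hpow _) _)
    _ = C * (volume (ball (0 : ℂ) 1) + ∫⁻ q in bidisc,
          ‖G q‖ₑ ^ (4 / 3 : ℝ) * logDiscWeight ε q.2) := by
        rw [lintegral_const_mul' _ _ hC, lintegral_add_left measurable_const, setLIntegral_one,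
          restrict_bidisc, lintegral_prod _ hGWm.aemeasurable]
    _ < ∞ := (ENNReal.mul_ne_top hC (ENNReal.add_ne_top.2 ⟨measure_ball_lt_top.ne, hNfin⟩)).lt_top

theorem enorm_discKernel {z v : ℂ} (hz : ‖z‖ < 1) (hv : ‖v‖ < 1) :
    ‖((1 - z * conj v) ^ 2)⁻¹‖ₑ = discAbsKernel z v := by
  rw [enorm_inv (pow_ne_zero 2 (one_sub_mul_conj_ne_zero hz hv)), enorm_pow, discAbsKernel]

theorem enorm_kernelOperator_hartogsMap_le {f : ℂ × ℂ → ℂ}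
    (hf : AEStronglyMeasurable f (volume.restrict hartogsTriangle)) {p : ℂ × ℂ} (hp : p ∈ bidisc)
    (hp2 : p.2 ≠ 0) :
    ‖kernelOperator hartogsTriangle hartogsKernel f (hartogsMap p)‖ₑ ≤
      ‖p.2‖ₑ⁻¹ * ∫⁻ q in bidisc, discAbsKernel p.1 q.1 *
        (discAbsKernel p.2 q.2 * ‖bidiscPullback f q‖ₑ) := by
  have hp1' : ‖p.1‖ < 1 := by simpa using hp.1
  have hp2' : ‖p.2‖ < 1 := by simpa using hp.2
  rw [kernelOperator_hartogsMap hf hp2, enorm_mul]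
  refine mul_le_mul' ?_ ((enorm_integral_le_lintegral_enorm _).trans (le_of_eq ?_))
  · have hpi : (1 : ℝ) ≤ Real.pi ^ 2 := by nlinarith [Real.pi_gt_three]
    have hpic : (Real.pi : ℂ) ^ 2 ≠ 0 := by exact_mod_cast (pow_ne_zero 2 Real.pi_ne_zero)
    rw [enorm_inv (mul_ne_zero hpic hp2), ENNReal.inv_le_inv, enorm_mul]
    have h1 : 1 ≤ ‖(Real.pi : ℂ) ^ 2‖ₑ := by
      rw [← ofReal_norm, ENNReal.one_le_ofReal]
      simpa using hpi
    exact le_mul_of_one_le_left' h1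
  · refine setLIntegral_congr_fun measurableSet_bidisc fun q hq => ?_
    have hq1 : ‖q.1‖ < 1 := by simpa using hq.1
    have hq2 : ‖q.2‖ < 1 := by simpa using hq.2
    rw [enorm_mul, enorm_mul, enorm_discKernel hp1' hq1, enorm_discKernel hp2' hq2,
      mul_comm ‖bidiscPullback f q‖ₑ]

/-- A strong-type estimate. On the output side the Jacobian and the factor `1/v` leave `|v|^(2/3)`,
which is bounded by `1` and discarded. -/
theorem exists_lintegral_kernelOperator_rpow_le {ε : ℝ} (hε : 1 / 3 < ε) :
    ∃ C : ℝ≥0∞, C ≠ ∞ ∧ ∀ f : ℂ × ℂ → ℂ, MemLp f (4 / 3) (logWeightedMeasure ε) →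
      ∫⁻ z in hartogsTriangle,
        ‖kernelOperator hartogsTriangle hartogsKernel f z‖ₑ ^ (4 / 3 : ℝ) ≤
      C * eLpNorm f (4 / 3) (logWeightedMeasure ε) ^ (4 / 3 : ℝ) := by
  obtain ⟨C, hC, h⟩ := exists_lintegral_bidisc_rpow_le hε
  refine ⟨C, hC, fun f hf => ?_⟩
  have hfm := hf.1.mono_ac (restrict_hartogsTriangle_absolutelyContinuous ε)
  have hFm := aestronglyMeasurable_bidiscPullback hfm
  have hPm : AEStronglyMeasurable (kernelOperator hartogsTriangle hartogsKernel f)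
      (volume.restrict hartogsTriangle) :=
    (differentiableOn_kernelOperator hfm
      (integrable_inv_norm_snd_mul_of_logWeightedMeasure hε hf)).continuousOn.aestronglyMeasurable
      isOpen_hartogsTriangle.measurableSet
  rw [setLIntegral_hartogsTriangle' (hPm.enorm.pow_const _),
    eLpNorm_logWeightedMeasure_rpow ε hfm]
  obtain ⟨G, hGs, hFG⟩ := hFm
  have hcongr : ∀ p : ℂ × ℂ, ∫⁻ q in bidisc, discAbsKernel p.1 q.1 *
      (discAbsKernel p.2 q.2 * ‖bidiscPullback f q‖ₑ) =
      ∫⁻ q in bidisc, discAbsKernel p.1 q.1 * (discAbsKernel p.2 q.2 * ‖G q‖ₑ) := fun p => by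
    refine lintegral_congr_ae ?_
    filter_upwards [hFG] with q hq
    rw [hq]
  have hcongr' : ∫⁻ q in bidisc, ‖bidiscPullback f q‖ₑ ^ (4 / 3 : ℝ) * logDiscWeight ε q.2 =
      ∫⁻ q in bidisc, ‖G q‖ₑ ^ (4 / 3 : ℝ) * logDiscWeight ε q.2 := by
    refine lintegral_congr_ae ?_
    filter_upwards [hFG] with q hq
    rw [hq]
  rw [hcongr']
  refine le_trans (lintegral_mono_ae ?_) (h _ hGs.enorm)
  filter_upwards [ae_bidisc_snd_ne_zero, ae_restrict_mem measurableSet_bidisc] with p hp2 hp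
  have hle := enorm_kernelOperator_hartogsMap_le hfm hp hp2
  rw [hcongr p] at hle
  have h0 : ‖p.2‖ₑ ≠ 0 := by simpa using hp2
  have h1 : ‖p.2‖ₑ ≤ 1 := by
    rw [← ofReal_norm, ← ENNReal.ofReal_one]
    exact ENNReal.ofReal_le_ofReal (by simpa using (mem_ball_zero_iff.1 hp.2).le)
  have h2 : ‖p.2‖ₑ ^ 2 * (‖p.2‖ₑ⁻¹) ^ (4 / 3 : ℝ) ≤ 1 := by
    calc ‖p.2‖ₑ ^ 2 * (‖p.2‖ₑ⁻¹) ^ (4 / 3 : ℝ)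
        ≤ ‖p.2‖ₑ ^ (4 / 3 : ℝ) * (‖p.2‖ₑ⁻¹) ^ (4 / 3 : ℝ) := by
          gcongr
          rw [← ENNReal.rpow_natCast]
          exact ENNReal.rpow_le_rpow_of_exponent_ge h1 (by norm_num)
      _ = 1 := by
          rw [← ENNReal.mul_rpow_of_nonneg _ _ (by norm_num),
            ENNReal.mul_inv_cancel h0 enorm_ne_top, ENNReal.one_rpow]
  calc ‖p.2‖ₑ ^ 2 * ‖kernelOperator hartogsTriangle hartogsKernel f (hartogsMap p)‖ₑ ^ (4 / 3 : ℝ)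
      ≤ ‖p.2‖ₑ ^ 2 * (‖p.2‖ₑ⁻¹ * ∫⁻ q in bidisc, discAbsKernel p.1 q.1 *
          (discAbsKernel p.2 q.2 * ‖G q‖ₑ)) ^ (4 / 3 : ℝ) := by gcongr
    _ = ‖p.2‖ₑ ^ 2 * (‖p.2‖ₑ⁻¹) ^ (4 / 3 : ℝ) * (∫⁻ q in bidisc, discAbsKernel p.1 q.1 *
          (discAbsKernel p.2 q.2 * ‖G q‖ₑ)) ^ (4 / 3 : ℝ) := by
        rw [ENNReal.mul_rpow_of_nonneg _ _ (by norm_num), mul_assoc]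
    _ ≤ _ := mul_le_of_le_one_left' h2

theorem integrable_bergmanKernel_mul {ε : ℝ} (hε : 1 / 3 < ε) {f : ℂ × ℂ → ℂ}
    (hf : MemLp f (4 / 3) (logWeightedMeasure ε)) {z : ℂ × ℂ} (hz : z ∈ hartogsTriangle) :
    Integrable (fun w => bergmanKernel hartogsTriangle z w * f w)
      (volume.restrict hartogsTriangle) := by
  refine (integrable_hartogsKernel_mul
    (hf.1.mono_ac (restrict_hartogsTriangle_absolutelyContinuous ε))
    (integrable_inv_norm_snd_mul_of_logWeightedMeasure hε hf) hz).congr ?_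
  filter_upwards [bergmanKernel_hartogsTriangle_ae_eq hz] with w hw
  rw [hw]

theorem setOf_lt_bergmanProjection (f : ℂ × ℂ → ℂ) (t : ℝ) :
    {z ∈ hartogsTriangle | t < ‖bergmanProjection hartogsTriangle f z‖} =
      {z ∈ hartogsTriangle | t < ‖kernelOperator hartogsTriangle hartogsKernel f z‖} := by
  ext z
  refine and_congr_right fun hz => ?_
  rw [bergmanProjection_hartogsTriangle_eq hz]

theorem exists_weakFourThirdsBound {ε : ℝ} (hε : 1 / 3 < ε) :
    ∃ C : ℝ≥0, ∀ f : ℂ × ℂ → ℂ, MemLp f (4 / 3) (logWeightedMeasure ε) →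
      WeakFourThirdsBound ε C f := by
  obtain ⟨C, hC, h⟩ := exists_lintegral_kernelOperator_rpow_le hε
  refine ⟨C.toNNReal, fun f hf t ht => ?_⟩
  have hfm := hf.1.mono_ac (restrict_hartogsTriangle_absolutelyContinuous ε)
  have hPm : AEStronglyMeasurable (kernelOperator hartogsTriangle hartogsKernel f)
      (volume.restrict hartogsTriangle) :=
    (differentiableOn_kernelOperator hfm
      (integrable_inv_norm_snd_mul_of_logWeightedMeasure hε hf)).continuousOn.aestronglyMeasurable
      isOpen_hartogsTriangle.measurableSet
  have htp : 0 < t ^ (4 / 3 : ℝ) := Real.rpow_pos_of_pos ht _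
  rw [ENNReal.coe_toNNReal hC, setOf_lt_bergmanProjection]
  refine le_trans ?_ ((meas_ge_le_lintegral_div (hPm.enorm.pow_const (4 / 3 : ℝ))
    (ε := ENNReal.ofReal (t ^ (4 / 3 : ℝ))) (by simpa using htp) ENNReal.ofReal_ne_top).trans
    (ENNReal.div_le_div_right (h f hf) _))
  rw [Measure.restrict_apply' isOpen_hartogsTriangle.measurableSet]
  refine measure_mono fun z hz => ⟨?_, hz.1⟩
  rw [mem_ofPred_eq, ← ofReal_norm, ENNReal.ofReal_rpow_of_nonneg (norm_nonneg _) (by norm_num)]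
  exact ENNReal.ofReal_le_ofReal (Real.rpow_le_rpow ht.le hz.2.le (by norm_num))

/-! ### Failure of the weak-type estimate at the critical exponent -/

/-- The radial profile `r⁻² (1 - log r)⁻¹`, cut off near the origin. -/
noncomputable def logProfile (δ : ℝ) : ℝ → ℝ :=
  (Ioi δ).indicator fun r => (r ^ 2)⁻¹ * (-Real.log r + 1)⁻¹

theorem measurable_logProfile (δ : ℝ) : Measurable (logProfile δ) :=
  Measurable.indicator (by fun_prop) measurableSet_Ioi

theorem logProfile_nonneg {δ r : ℝ} (hr0 : 0 ≤ r) (hr1 : r ≤ 1) : 0 ≤ logProfile δ r := by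
  refine indicator_apply_nonneg fun _ => ?_
  have := one_pos.trans_le (one_le_one_sub_log hr0 hr1)
  positivity

theorem logProfile_le {δ r : ℝ} (hδ : 0 < δ) (hr1 : r ≤ 1) : logProfile δ r ≤ (δ ^ 2)⁻¹ := by
  refine indicator_apply_le' (fun h => ?_) (fun _ => by positivity)
  have hr : δ < r := h
  have h1 := one_le_one_sub_log (hδ.trans hr).le hr1
  calc (r ^ 2)⁻¹ * (-Real.log r + 1)⁻¹ ≤ (δ ^ 2)⁻¹ * 1 := by
        gcongr
        exact inv_le_one_of_one_le₀ h1
    _ = _ := mul_one _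

theorem integrableOn_logProfile_norm {δ : ℝ} (hδ : 0 < δ) :
    IntegrableOn (fun v : ℂ => logProfile δ ‖v‖) (ball 0 1) := by
  refine Integrable.of_bound
    ((measurable_logProfile δ).comp measurable_norm).aestronglyMeasurable (δ ^ 2)⁻¹ ?_
  filter_upwards [ae_ball_ne_zero_and_norm_lt] with v hv
  rw [Real.norm_of_nonneg (logProfile_nonneg (norm_nonneg v) hv.2.le)]
  exact logProfile_le hδ hv.2.le

/-- In polar coordinates this is `2π ∫_δ^1 dr / (r (1 - log r)) = 2π log (1 - log δ)`; the cutoff `δ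
= exp (1 - exp s)` is chosen to make the logarithm equal to `s`. -/
theorem setIntegral_logProfile_norm {s : ℝ} (hs : 0 < s) :
    ∫ v in ball (0 : ℂ) 1, logProfile (Real.exp (1 - Real.exp s)) ‖v‖ = 2 * Real.pi * s := by
  set δ := Real.exp (1 - Real.exp s) with hδdef
  have hδ : 0 < δ := Real.exp_pos _
  have hδ1 : δ < 1 := by
    rw [hδdef, Real.exp_lt_one_iff]
    linarith [Real.add_one_lt_exp hs.ne']
  have hcast : ((∫ v in ball (0 : ℂ) 1, logProfile δ ‖v‖ : ℝ) : ℂ) =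
      ((∫ r in Ioo (0 : ℝ) 1, 2 * Real.pi * r * logProfile δ r : ℝ) : ℂ) := by
    rw [← integral_complex_ofReal, ← integral_complex_ofReal,
      setIntegral_ball_polar (F := fun v : ℂ => ((logProfile δ ‖v‖ : ℝ) : ℂ))
        (integrableOn_logProfile_norm hδ).ofReal]
    refine setIntegral_congr_fun measurableSet_Ioo fun r hr => ?_
    have hav : Real.circleAverage (fun v : ℂ => ((logProfile δ ‖v‖ : ℝ) : ℂ)) 0 r =
        logProfile δ r := Real.circleAverage_const_on_circle fun v hv => by
      have : ‖v‖ = r := by simpa [abs_of_pos hr.1] using hv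
      rw [this]
    change _ • Real.circleAverage (fun v : ℂ => ((logProfile δ ‖v‖ : ℝ) : ℂ)) 0 r = _
    rw [hav, Complex.real_smul]
    push_cast
    ring
  rw [Complex.ofReal_injective hcast]
  have hind : ∀ r : ℝ, 2 * Real.pi * r * logProfile δ r =
      (Ioi δ).indicator (fun r => 2 * Real.pi * r * ((r ^ 2)⁻¹ * (-Real.log r + 1)⁻¹)) r :=
    fun r => by by_cases h : r ∈ Ioi δ <;> simp [logProfile, indicator, h]
  simp only [hind]
  rw [setIntegral_indicator measurableSet_Ioi, Ioo_inter_Ioi, max_eq_right hδ.le,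
    ← integral_Ioc_eq_integral_Ioo, ← intervalIntegral.integral_of_le hδ1.le]
  have hpos : ∀ r ∈ uIcc δ 1, 0 < r ∧ 0 < -Real.log r + 1 := fun r hr => by
    rw [uIcc_of_le hδ1.le] at hr
    have h0 := hδ.trans_le hr.1
    exact ⟨h0, one_pos.trans_le (one_le_one_sub_log h0.le hr.2)⟩
  rw [intervalIntegral.integral_eq_sub_of_hasDerivAt
    (f := fun r => -(2 * Real.pi) * Real.log (-Real.log r + 1))]
  · simp only [Real.log_one, neg_zero, zero_add, mul_zero, zero_sub]
    rw [hδdef, Real.log_exp, show -(1 - Real.exp s) + 1 = Real.exp s by ring, Real.log_exp]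
    ring
  · intro r hr
    obtain ⟨h0, h1⟩ := hpos r hr
    have h2 : HasDerivAt (fun r => -Real.log r + 1) (-r⁻¹) r :=
      ((Real.hasDerivAt_log h0.ne').neg).add_const 1
    refine ((h2.log h1.ne').const_mul (-(2 * Real.pi))).congr_deriv ?_
    field_simp
  · refine ContinuousOn.intervalIntegrable fun r hr => ContinuousAt.continuousWithinAt ?_
    obtain ⟨h0, h1⟩ := hpos r hr
    have c1 : ContinuousAt (fun r : ℝ => (r ^ 2)⁻¹) r :=
      ContinuousAt.inv₀ (by fun_prop) (pow_ne_zero 2 h0.ne')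
    have c2 : ContinuousAt (fun r : ℝ => (-Real.log r + 1)⁻¹) r :=
      ContinuousAt.inv₀ (((Real.continuousAt_log h0.ne').neg).add continuousAt_const) h1.ne'
    exact ContinuousAt.mul (by fun_prop) (c1.mul c2)

/-- The near-extremal functions on the Hartogs triangle. -/
noncomputable def logExtremizer (δ : ℝ) (w : ℂ × ℂ) : ℂ := (logProfile δ ‖w.2‖ : ℂ) / w.2

theorem measurable_logExtremizer (δ : ℝ) : Measurable (logExtremizer δ) := by
  have := measurable_logProfile δ
  unfold logExtremizer
  fun_prop

theorem bidiscPullback_logExtremizer (δ : ℝ) {q : ℂ × ℂ} (hq : q.2 ≠ 0) :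
    bidiscPullback (logExtremizer δ) q = logProfile δ ‖q.2‖ := by
  simp only [bidiscPullback, logExtremizer, hartogsMap]
  field_simp

theorem volume_ball_zero_one : volume (ball (0 : ℂ) 1) = ENNReal.ofReal Real.pi := by
  rw [Complex.volume_ball, ENNReal.ofReal_one, one_pow, one_mul]
  exact ENNReal.ofReal_coe_nnreal.symm

/-- The pullback is constant in `u` and radial in `v`, so both disc kernels integrate as `1`, giving
`(π² z₂)⁻¹ · π · 2π s`. -/
theorem kernelOperator_logExtremizer {s : ℝ} (hs : 0 < s) {z : ℂ × ℂ} (hz : z ∈ hartogsTriangle) :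
    kernelOperator hartogsTriangle hartogsKernel
      (logExtremizer (Real.exp (1 - Real.exp s))) z = ((2 * s : ℝ) : ℂ) / z.2 := by
  set δ := Real.exp (1 - Real.exp s) with hδdef
  have hz2 := snd_ne_zero_of_mem_hartogsTriangle hz
  have hzΦ : hartogsMap (z.1 / z.2, z.2) = z := by
    simp [hartogsMap, div_mul_cancel₀ _ hz2]
  have hcongr : ∫ q in bidisc, ((1 - z.1 / z.2 * conj q.1) ^ 2)⁻¹ *
        (bidiscPullback (logExtremizer δ) q * ((1 - z.2 * conj q.2) ^ 2)⁻¹) =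
      ∫ q in bidisc, ((1 - z.1 / z.2 * conj q.1) ^ 2)⁻¹ *
        ((logProfile δ ‖q.2‖ : ℂ) * ((1 - z.2 * conj q.2) ^ 2)⁻¹) := by
    refine integral_congr_ae ?_
    filter_upwards [ae_bidisc_snd_ne_zero] with q hq
    rw [bidiscPullback_logExtremizer δ hq]
  have hone := integral_radial_mul_discKernel (φ := fun _ => 1)
    (integrable_const 1) (norm_div_lt_one_of_mem_hartogsTriangle hz)
  have hvol : ∫ _ in ball (0 : ℂ) 1, (1 : ℂ) = Real.pi := by
    rw [setIntegral_const, measureReal_def, volume_ball_zero_one,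
      ENNReal.toReal_ofReal Real.pi_pos.le]
    simp
  have hrad := integral_radial_mul_discKernel (φ := fun r => (logProfile δ r : ℂ))
    (integrableOn_logProfile_norm (Real.exp_pos _)).ofReal hz.2
  have hpi : (Real.pi : ℂ) ≠ 0 := by exact_mod_cast Real.pi_ne_zero
  have hM : ∫ v in ball (0 : ℂ) 1, ((logProfile δ ‖v‖ : ℝ) : ℂ) = ((2 * Real.pi * s : ℝ) : ℂ) := by
    rw [integral_complex_ofReal, setIntegral_logProfile_norm hs]
  simp only [one_mul] at hone
  conv_lhs => rw [← hzΦ]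
  rw [kernelOperator_hartogsMap (p := (z.1 / z.2, z.2))
    (measurable_logExtremizer δ).aestronglyMeasurable hz2]
  simp only
  rw [hcongr, restrict_bidisc, integral_prod_mul (fun u : ℂ => ((1 - z.1 / z.2 * conj u) ^ 2)⁻¹)
    (fun v : ℂ => (logProfile δ ‖v‖ : ℂ) * ((1 - z.2 * conj v) ^ 2)⁻¹), hone, hvol, hrad, hM]
  push_cast
  field_simp

/-- With `x = 1 - log r ≥ 1`, the left side is `r^(-2) x^(ε - 4/3)` where the profile is nonzero,
and `ε - 4/3 ≤ -1`. The profile is thus chosen so that its weighted `4/3`-power is dominated by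
itself. -/
theorem logProfile_rpow_mul_logDiscWeight_le {ε : ℝ} (hε : ε ≤ 1 / 3) {δ : ℝ} {v : ℂ}
    (hv0 : v ≠ 0) (hv1 : ‖v‖ < 1) :
    ‖((logProfile δ ‖v‖ : ℝ) : ℂ)‖ₑ ^ (4 / 3 : ℝ) * logDiscWeight ε v ≤
      ENNReal.ofReal (logProfile δ ‖v‖) := by
  have hr := norm_pos_iff.2 hv0
  have hx := one_le_one_sub_log hr.le hv1.le
  have hφ := logProfile_nonneg (δ := δ) hr.le hv1.le
  rw [← ofReal_norm, Complex.norm_real, Real.norm_of_nonneg hφ,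
    ENNReal.ofReal_rpow_of_nonneg hφ (by norm_num), logDiscWeight_eq_ofReal,
    ← ENNReal.ofReal_mul (by positivity)]
  refine ENNReal.ofReal_le_ofReal ?_
  by_cases h : ‖v‖ ∈ Ioi δ
  · rw [logProfile, indicator_of_mem h]
    have hx0 : 0 < -Real.log ‖v‖ + 1 := one_pos.trans_le hx
    set r := ‖v‖ with hrdef
    set x := -Real.log r + 1 with hxdef
    have e1 : ((r ^ 2)⁻¹ * x⁻¹) ^ (4 / 3 : ℝ) = r ^ (-(8 / 3) : ℝ) * x ^ (-(4 / 3) : ℝ) := by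
      rw [Real.mul_rpow (by positivity) (by positivity), ← Real.rpow_natCast r 2,
        ← Real.rpow_neg hr.le, ← Real.rpow_mul hr.le, ← Real.rpow_neg_one x, ← Real.rpow_mul hx0.le]
      norm_num
    calc ((r ^ 2)⁻¹ * x⁻¹) ^ (4 / 3 : ℝ) * (r ^ (2 / 3 : ℝ) * x ^ ε)
        = (r ^ (-(8 / 3) : ℝ) * r ^ (2 / 3 : ℝ)) * (x ^ (-(4 / 3) : ℝ) * x ^ ε) := by
          rw [e1]; ring
      _ = r ^ (-2 : ℝ) * x ^ (-(4 / 3) + ε) := by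
          rw [← Real.rpow_add hr, ← Real.rpow_add hx0]; norm_num
      _ ≤ r ^ (-2 : ℝ) * x ^ (-1 : ℝ) := by
          gcongr
          linarith
      _ = (r ^ 2)⁻¹ * x⁻¹ := by
          rw [Real.rpow_neg_one, Real.rpow_neg hr.le, Real.rpow_two]
  · rw [logProfile, indicator_of_notMem h, Real.zero_rpow (by norm_num), zero_mul]

theorem eLpNorm_logExtremizer_rpow_le {ε : ℝ} (hε : ε ≤ 1 / 3) {s : ℝ} (hs : 0 < s) :
    eLpNorm (logExtremizer (Real.exp (1 - Real.exp s))) (4 / 3) (logWeightedMeasure ε) ^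
      (4 / 3 : ℝ) ≤ ENNReal.ofReal (Real.pi * (2 * Real.pi * s)) := by
  set δ := Real.exp (1 - Real.exp s) with hδdef
  have hδ : 0 < δ := Real.exp_pos _
  have hm : Measurable fun q : ℂ × ℂ => ENNReal.ofReal (logProfile δ ‖q.2‖) :=
    ((measurable_logProfile δ).comp (measurable_norm.comp measurable_snd)).ennreal_ofReal
  rw [eLpNorm_logWeightedMeasure_rpow ε (measurable_logExtremizer δ).aestronglyMeasurable]
  calc ∫⁻ q in bidisc, ‖bidiscPullback (logExtremizer δ) q‖ₑ ^ (4 / 3 : ℝ) * logDiscWeight ε q.2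
      ≤ ∫⁻ q in bidisc, ENNReal.ofReal (logProfile δ ‖q.2‖) := by
        refine lintegral_mono_ae ?_
        filter_upwards [ae_bidisc_snd_ne_zero, ae_restrict_mem measurableSet_bidisc] with q hq2 hq
        rw [bidiscPullback_logExtremizer δ hq2]
        exact logProfile_rpow_mul_logDiscWeight_le hε hq2 (mem_ball_zero_iff.1 hq.2)
    _ = ENNReal.ofReal Real.pi * ∫⁻ v in ball (0 : ℂ) 1, ENNReal.ofReal (logProfile δ ‖v‖) := by
        rw [restrict_bidisc, lintegral_prod _ hm.aemeasurable]
        simp only [lintegral_const, Measure.restrict_apply, MeasurableSet.univ, univ_inter,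
          volume_ball_zero_one]
        rw [mul_comm]
    _ = ENNReal.ofReal (Real.pi * (2 * Real.pi * s)) := by
        rw [← ofReal_integral_eq_lintegral_ofReal (integrableOn_logProfile_norm hδ),
          setIntegral_logProfile_norm hs, ENNReal.ofReal_mul Real.pi_pos.le]
        filter_upwards [ae_ball_ne_zero_and_norm_lt] with v hv
        exact logProfile_nonneg (norm_nonneg v) hv.2.le

theorem memLp_logExtremizer_logWeightedMeasure {ε : ℝ} (hε : ε ≤ 1 / 3) {s : ℝ} (hs : 0 < s) :
    MemLp (logExtremizer (Real.exp (1 - Real.exp s))) (4 / 3) (logWeightedMeasure ε) := by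
  refine ⟨(measurable_logExtremizer _).aestronglyMeasurable, ?_⟩
  have h := (eLpNorm_logExtremizer_rpow_le hε hs).trans_lt ENNReal.ofReal_lt_top
  exact (ENNReal.rpow_lt_top_iff_of_pos (by norm_num)).1 h

theorem volume_hartogsTriangle_ne_top : volume hartogsTriangle ≠ ∞ := by
  refine ne_top_of_le_ne_top (measure_ball_lt_top (x := (0 : ℂ × ℂ)) (r := 1)).ne
    (measure_mono fun z hz => ?_)
  rw [mem_ball_zero_iff, Prod.norm_def]
  exact max_lt (hz.1.trans hz.2) hz.2

theorem volume_hartogsTriangle_ne_zero : volume hartogsTriangle ≠ 0 :=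
  isOpen_hartogsTriangle.measure_ne_zero _ ⟨(0, 1 / 2), by norm_num [hartogsTriangle]⟩

theorem memLp_logExtremizer_two {δ : ℝ} (hδ : 0 < δ) :
    MemLp (logExtremizer δ) 2 (volume.restrict hartogsTriangle) := by
  have : IsFiniteMeasure (volume.restrict hartogsTriangle) :=
    isFiniteMeasure_restrict.2 volume_hartogsTriangle_ne_top
  refine MemLp.of_bound (measurable_logExtremizer δ).aestronglyMeasurable ((δ ^ 2)⁻¹ * δ⁻¹) ?_
  filter_upwards [ae_mem_hartogsTriangle] with z hz
  have h0 := logProfile_nonneg (δ := δ) (norm_nonneg z.2) hz.2.le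
  rw [logExtremizer, norm_div, Complex.norm_real, Real.norm_of_nonneg h0, div_eq_mul_inv]
  by_cases h : δ < ‖z.2‖
  · gcongr
    exact logProfile_le hδ hz.2.le
  · rw [logProfile, indicator_of_notMem (by exact h), zero_mul]
    positivity

/-- At level `t = 2s` the superlevel set is the whole triangle, because `|z₂| < 1`. The estimate
then reads `V (2s)^(4/3) ≤ 2π² C s`, which is false for large `s`. -/
theorem not_exists_weakFourThirdsBound {ε : ℝ} (hε : ε ≤ 1 / 3) :
    ¬ ∃ C : ℝ≥0, ∀ f : ℂ × ℂ → ℂ, MemLp f (4 / 3) (logWeightedMeasure ε) →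
      MemLp f 2 (volume.restrict hartogsTriangle) → WeakFourThirdsBound ε C f := by
  rintro ⟨C, hC⟩
  set V := (volume hartogsTriangle).toReal with hV
  have hVpos : 0 < V :=
    ENNReal.toReal_pos volume_hartogsTriangle_ne_zero volume_hartogsTriangle_ne_top
  have key : ∀ x : ℝ, 0 < x → V * x ≤ C * Real.pi ^ 2 := by
    intro x hx
    -- This choice makes `(2s)^(4/3) = x⁴` and `2s = x³`, so the inequality becomes linear in `x`.
    obtain ⟨s, hs⟩ : ∃ s : ℝ, s = x ^ 3 / 2 := ⟨_, rfl⟩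
    have hs0 : 0 < s := by rw [hs]; positivity
    have hb := hC _ (memLp_logExtremizer_logWeightedMeasure hε hs0)
      (memLp_logExtremizer_two (Real.exp_pos _)) (2 * s) (by positivity)
    have hset : {z ∈ hartogsTriangle | 2 * s < ‖bergmanProjection hartogsTriangle
        (logExtremizer (Real.exp (1 - Real.exp s))) z‖} = hartogsTriangle := by
      rw [setOf_lt_bergmanProjection]
      refine sep_eq_self_iff_mem_true.2 fun z hz => ?_
      have hz2 := norm_pos_iff.2 (snd_ne_zero_of_mem_hartogsTriangle hz)
      rw [kernelOperator_logExtremizer hs0 hz, norm_div, Complex.norm_real,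
        Real.norm_of_nonneg (by positivity), lt_div_iff₀ hz2]
      exact mul_lt_of_lt_one_right (by positivity) hz.2
    have hpow : (2 * s) ^ (4 / 3 : ℝ) = x ^ 4 := by
      rw [hs, mul_div_cancel₀ _ two_ne_zero, ← Real.rpow_natCast x 3, ← Real.rpow_mul hx.le,
        ← Real.rpow_natCast x 4]
      norm_num
    rw [hset, hpow] at hb
    have hb2 : volume hartogsTriangle ≤
        ENNReal.ofReal (C * (Real.pi * (2 * Real.pi * s)) / x ^ 4) := by
      refine hb.trans ?_
      rw [ENNReal.ofReal_div_of_pos (by positivity), ENNReal.ofReal_mul C.coe_nonneg,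
        ENNReal.ofReal_coe_nnreal]
      gcongr
      exact eLpNorm_logExtremizer_rpow_le hε hs0
    have hb3 : V ≤ C * (Real.pi * (2 * Real.pi * s)) / x ^ 4 :=
      ENNReal.toReal_le_of_le_ofReal (by positivity) hb2
    calc V * x ≤ C * (Real.pi * (2 * Real.pi * s)) / x ^ 4 * x := by gcongr
      _ = C * Real.pi ^ 2 := by rw [hs]; field_simp
  -- At this `x` the bound would read `Cπ² + V ≤ Cπ²`.
  have h := key (C * Real.pi ^ 2 / V + 1) (by positivity)
  rw [mul_add, mul_div_cancel₀ _ hVpos.ne'] at h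
  linarith

theorem theorem4p7 :
    -- the Bergman kernel of the Hartogs triangle exists
    IsBergmanKernel hartogsTriangle (bergmanKernel hartogsTriangle) ∧
    -- for `ε > 1/3` the projection is defined by absolutely convergent integrals on the weighted
    -- space and the weak-type estimate holds
    (∀ ε : ℝ, 1 / 3 < ε →
      (∀ f : ℂ × ℂ → ℂ, MemLp f (4 / 3) (logWeightedMeasure ε) → ∀ z ∈ hartogsTriangle,
        Integrable (fun w => bergmanKernel hartogsTriangle z w * f w)
          (volume.restrict hartogsTriangle)) ∧
      ∃ C : ℝ≥0, ∀ f : ℂ × ℂ → ℂ, MemLp f (4 / 3) (logWeightedMeasure ε) →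
        WeakFourThirdsBound ε C f) ∧
    -- for `ε ≤ 1/3` it fails, even for square-integrable functions
    (∀ ε : ℝ, ε ≤ 1 / 3 →
      ¬ ∃ C : ℝ≥0, ∀ f : ℂ × ℂ → ℂ, MemLp f (4 / 3) (logWeightedMeasure ε) →
        MemLp f 2 (volume.restrict hartogsTriangle) → WeakFourThirdsBound ε C f) :=
  ⟨isBergmanKernel_bergmanKernel_hartogsTriangle,
    fun _ hε => ⟨fun _ hf _ hz => integrable_bergmanKernel_mul hε hf hz,
      exists_weakFourThirdsBound hε⟩,
    fun _ hε => not_exists_weakFourThirdsBound hε⟩
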